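/- Let $\mathcal A$ be a finite alphabet with the discrete topology, let $\sigma$ be the left shift on $\mathcal A^{\mathbb Z}$ (product topology), and let $X\subset\mathcal A^{\mathbb Z}$ be an infinite subshift (closed and $\sigma$-invariant) that is transitive, i.e. $X=\overline{\{\sigma^n x\}_{n\in\mathbb Z}}$ for some $x\in X$. Assume that $X$ is not the orbit closure of a sequence which is eventually periodic both to the left and to the right. Let $p(q)$ be the number of words of length $q$ in the language $L(X)$ (the set of all finite words occurring in points of $X$), and suppose $\limsup_{q\to\infty} p(q)/q<4/3$. For positive integers $m<n$ let $\tau_{m,n}$ be the substitution $0\mapsto 0^{m-1}1$, $1\mapsto 0^{n-1}1$. Then there exist a substitution $\pi:\{0,1\}\to\mathcal A^*$ such that $\pi(0),\pi(1)$ begin with different letters and $|\pi(0)|<|\pi(1)|<2|\pi(0)|$, and integer sequences $(m_k)_{k\ge1},(n_k)_{k\ge1}$ with $0<m_k<n_k$, such that $X$ is the orbit closure of $$\lim_{k\to\infty}(\pi\circ\tau_{m_1,n_1}\circ\cdots\circ\tau_{m_k,n_k})(0).$$ Precisely: these words converge, letter by letter from their right ends, to a left-infinite word, and $X$ is the orbit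 closure of some $x\in X$ containing this left-infinite word; and whenever they also converge, letter by letter from their left ends, to a right-infinite word, $X$ is likewise the orbit closure of some $x\in X$ containing that right-infinite word. In addition: - $n_k\le 2m_k$ whenever $m_k>1$; - $n_k<1.9\,m_k$ whenever $m_k>4$; - $n_k\le 3$ whenever $m_k=1$; - if $m_{k+1}=1$ and $n_{k+1}=3$, then $n_k=m_k+1$; - the left-infinite words $\pi(0)^\infty$ and $\pi(0)^\infty\pi(1)$ have a (finite) maximal common suffix $s$, and every right-special word of length at least $|s\,\pi(0)^{m_1-1}|$ is a suffix of a concatenation of copies of $\pi(0)$ and $\pi(1)$. Here $w\in L(X)$ is right-special if $wa,wb\in L(X)$ for two letters $a\ne b$. -/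

import Mathlib

namespace LowComplexity

variable {A : Type*}

/-- The left shift on two-sided sequences. -/
def shift (x : ℤ → A) : ℤ → A := fun i => x (i + 1)

/-- The two-sided orbit of `x` under the shift. -/
def orbit (x : ℤ → A) : Set (ℤ → A) := {z | ∃ j : ℤ, ∀ i : ℤ, z i = x (i + j)}

/-- `X` is a subshift: a closed, shift-invariant subset of the full shift (product topology). -/
structure IsSubshift [TopologicalSpace A] (X : Set (ℤ → A)) : Prop where
  isClosed : IsClosed X
  invariant : shift '' X = X

/-- `X` is the closure of the orbit of one of its points. -/
def IsTransitive [TopologicalSpace A] (X : Set (ℤ → A)) : Prop :=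
  ∃ x ∈ X, X = closure (orbit x)

/-- The sequence `x` is eventually periodic to the right and eventually periodic to the left
(the two periods may differ). -/
def EventuallyPeriodicBothSides (x : ℤ → A) : Prop :=
  (∃ p : ℤ, 0 < p ∧ ∃ N : ℤ, ∀ i, N ≤ i → x (i + p) = x i) ∧
    (∃ p : ℤ, 0 < p ∧ ∃ N : ℤ, ∀ i, i ≤ N → x (i - p) = x i)

/-- The word `w` occurs in `x` at position `i`. -/
def OccursAt (w : List A) (x : ℤ → A) (i : ℤ) : Prop :=
  ∀ (j : ℕ) (hj : j < w.length), x (i + j) = w[j]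

/-- The language of `X`: all finite words occurring in points of `X`. -/
def language (X : Set (ℤ → A)) : Set (List A) :=
  {w | ∃ x ∈ X, ∃ i : ℤ, OccursAt w x i}

/-- The word complexity function: the number of words of length `q` in the language. -/
noncomputable def complexity (X : Set (ℤ → A)) (q : ℕ) : ℕ :=
  {w ∈ language X | w.length = q}.ncard

/-- A word of the language is right-special if it has two distinct one-letter extensions to the
right in the language. -/
def IsRightSpecial (X : Set (ℤ → A)) (w : List A) : Prop :=
  w ∈ language X ∧ ∃ a b : A, a ≠ b ∧ w ++ [a] ∈ language X ∧ w ++ [b] ∈ language X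

/-- The image of a finite word under a substitution (extension to concatenations). -/
def applyWord {B C : Type*} (π : B → List C) (w : List B) : List C := w.flatMap π

/-- The substitution `0 ↦ 0 ^ (m - 1) 1`, `1 ↦ 0 ^ (n - 1) 1`, used for positive `m`, `n`. -/
def tau (m n : ℕ) (a : Fin 2) : List (Fin 2) :=
  if a = 0 then List.replicate (m - 1) 0 ++ [1] else List.replicate (n - 1) 0 ++ [1]

/-- `rho m n k` is the composition of the first `k` substitutions `tau (m i) (n i)`, `i < k`, the
one with index `0` being outermost; the empty composition is the identity. -/
def rho (m n : ℕ → ℕ) : ℕ → Fin 2 → List (Fin 2)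
  | 0 => fun a => [a]
  | k + 1 => fun a => applyWord (rho m n k) (tau (m k) (n k) a)

/-- The words `w k` converge to the left-infinite word `… y 2, y 1, y 0`: for each `i`, the `i`-th
letter from the right end of `w k` is eventually `y i`. -/
def ConvergesLeftInfinite (w : ℕ → List A) (y : ℕ → A) : Prop :=
  ∀ i : ℕ, ∀ᶠ k in Filter.atTop, (w k).reverse[i]? = some (y i)

/-- The words `w k` converge to the right-infinite word `y 0, y 1, y 2 …`: for each `i`, the `i`-th
letter from the left end of `w k` is eventually `y i`. -/
def ConvergesRightInfinite (w : ℕ → List A) (y : ℕ → A) : Prop :=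
  ∀ i : ℕ, ∀ᶠ k in Filter.atTop, (w k)[i]? = some (y i)

/-- `X` is the orbit closure of the left-infinite word `… y 2, y 1, y 0`: it is the orbit closure
of a two-sided sequence in `X` containing that word. -/
def IsOrbitClosureOfLeftInfinite [TopologicalSpace A] (X : Set (ℤ → A)) (y : ℕ → A) : Prop :=
  ∃ x ∈ X, (∃ i : ℤ, ∀ j : ℕ, x (i - j) = y j) ∧ X = closure (orbit x)

/-- `X` is the orbit closure of the right-infinite word `y 0, y 1, y 2 …`: it is the orbit closure
of a two-sided sequence in `X` containing that word. -/
def IsOrbitClosureOfRightInfinite [TopologicalSpace A] (X : Set (ℤ → A)) (y : ℕ → A) : Prop :=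
  ∃ x ∈ X, (∃ i : ℤ, ∀ j : ℕ, x (i + j) = y j) ∧ X = closure (orbit x)

/-- `s` is a suffix of the left-infinite word `v ^ ∞ u` (for `v` non-empty). -/
def IsSuffixOfPowTail (v u s : List A) : Prop :=
  ∃ t : ℕ, s <:+ (List.replicate t v).flatten ++ u

/-- `s` is the maximal common suffix of the left-infinite words `v ^ ∞` and `v ^ ∞ u`. -/
def IsMaxCommonSuffix (v u s : List A) : Prop :=
  (IsSuffixOfPowTail v [] s ∧ IsSuffixOfPowTail v u s) ∧
    ∀ s' : List A, IsSuffixOfPowTail v [] s' → IsSuffixOfPowTail v u s' → s' <:+ s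

end LowComplexity

/-! Low complexity leaves little room for right-special words. The number of factors grows by at
least the number of right-special words at each length, so a second right-special word over a long
range of lengths pushes the complexity above `4q/3`.

Reduction: a Baire category argument in `X` yields a generator `x` all of whose factors recur in
both directions and which is eventually periodic in neither (`exists_recurrent_generator`). At some
large length `q` the complexity grows by exactly one, so there is one right-special word, with two
continuations. Its two return words, read from just after it, have different first letters and code
`x` (`exists_level`).

Renormalization: a `Level` is a coding of `x` by two words of lengths `a ≤ b`, whose long
concatenations share exactly the suffix `s`; every right-special word at least as long as `s` ends
at a cut of the coding. If the runs of `0` between consecutive `1`s in the code took three lengths,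
or two lengths too far apart, a second right-special word would persist too long. So the runs have
two lengths, `j` and `j + 1 + d`, and the code is the image under `sigma` of a new code, giving a
new `Level` (`Level.step`). The suffix grows to `s' = s π(0 ^ j 1 0 ^ j)`. The cost is an excess of
at least `d * a` in the number of factors, while the complexity bound limits this excess.

Constraints: recording the lengths `a`, `b` and the excess turns all inequalities on `m = j + 1`, `n
= j + d + 2` into linear arithmetic (`Lengths`). The ratio condition `b < 2 * a` holds at some
level, which becomes the starting point of the sequence. It may fail later, but only after a step `j
= 0`, `d = 1`, whose excess still keeps the parameters under control (`Balanced`).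

Conclusion: `tau` and `sigma` are conjugate by a power of `0`, so the words built from `tau` occur
in `x`. The hierarchy of codings forces every factor to recur with bounded gaps, so `X` is minimal
and any of its points containing the limit word generates it. -/

namespace LowComplexity

variable {A : Type*}

/-! ### Factors of two-sided sequences -/

/-- The factor of length `q` of `x` at position `i`. -/
def fac (x : ℤ → A) (i : ℤ) (q : ℕ) : List A := (List.range q).map fun k : ℕ => x (i + k)

@[simp] theorem length_fac (x : ℤ → A) (i : ℤ) (q : ℕ) : (fac x i q).length = q := by
  simp [fac]

@[simp] theorem fac_zero (x : ℤ → A) (i : ℤ) : fac x i 0 = [] := rfl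

theorem getElem_fac (x : ℤ → A) (i : ℤ) (q k : ℕ) (h : k < (fac x i q).length) :
    (fac x i q)[k] = x (i + k) := by
  simp [fac]

theorem fac_add (x : ℤ → A) (i : ℤ) (q r : ℕ) :
    fac x i (q + r) = fac x i q ++ fac x (i + q) r := by
  simp only [fac, List.range_add, List.map_append, List.map_map]
  congr 1
  refine List.map_congr_left fun k _ => ?_
  simp [add_assoc]

theorem fac_one (x : ℤ → A) (i : ℤ) : fac x i 1 = [x i] := by simp [fac]

theorem fac_succ (x : ℤ → A) (i : ℤ) (q : ℕ) : fac x i (q + 1) = fac x i q ++ [x (i + q)] := by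
  rw [fac_add, fac_one]

theorem fac_succ_left (x : ℤ → A) (i : ℤ) (q : ℕ) : fac x i (q + 1) = x i :: fac x (i + 1) q := by
  rw [add_comm, fac_add, fac_one]; simp

theorem fac_eq_iff {x y : ℤ → A} {i j : ℤ} {q : ℕ} :
    fac x i q = fac y j q ↔ ∀ k : ℕ, k < q → x (i + k) = y (j + k) := by
  simp only [fac]
  rw [List.map_inj_left]
  simp

/-- Equality of factors restricts to subwindows. -/
theorem fac_eq_sub {x y : ℤ → A} {i j : ℤ} {q : ℕ} (h : fac x i q = fac y j q) (d : ℤ)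
    (hd : 0 ≤ d) (r : ℕ) (hr : d + r ≤ q) : fac x (i + d) r = fac y (j + d) r := by
  rw [fac_eq_iff] at h ⊢
  intro k hk
  have := h (d.toNat + k) (by omega)
  rw [show i + d + (k : ℤ) = i + ((d.toNat + k : ℕ) : ℤ) by push_cast; omega,
    show j + d + (k : ℤ) = j + ((d.toNat + k : ℕ) : ℤ) by push_cast; omega]
  exact this

theorem fac_eq_apply {x y : ℤ → A} {i j : ℤ} {q : ℕ} (h : fac x i q = fac y j q) (d : ℤ)
    (hd : 0 ≤ d) (hr : d < q) : x (i + d) = y (j + d) := by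
  have := fac_eq_sub h d hd 1 (by omega)
  simpa [fac_one] using this

/-- The word `w` is the factor of `x` at position `i`. -/
def Occ (w : List A) (x : ℤ → A) (i : ℤ) : Prop := fac x i w.length = w

theorem occ_iff_getElem {w : List A} {x : ℤ → A} {i : ℤ} :
    Occ w x i ↔ ∀ (j : ℕ) (hj : j < w.length), x (i + j) = w[j] := by
  constructor
  · intro h j hj
    have h2 := List.getElem_of_eq h (i := j) (by simpa using hj)
    rw [getElem_fac] at h2
    exact h2
  · intro h
    apply List.ext_getElem
    · simp
    · intro k h1 h2
      rw [getElem_fac]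
      exact h k h2

theorem occ_iff_occursAt {w : List A} {x : ℤ → A} {i : ℤ} : Occ w x i ↔ OccursAt w x i :=
  occ_iff_getElem

theorem occ_fac (x : ℤ → A) (i : ℤ) (q : ℕ) : Occ (fac x i q) x i := by
  simp [Occ]

theorem occ_append {u v : List A} {x : ℤ → A} {i : ℤ} :
    Occ (u ++ v) x i ↔ Occ u x i ∧ Occ v x (i + u.length) := by
  simp only [Occ, List.length_append, fac_add]
  constructor
  · intro h
    exact List.append_inj h (by simp)
  · rintro ⟨h1, h2⟩
    rw [h1, h2]

theorem occ_nil (x : ℤ → A) (i : ℤ) : Occ [] x i := rfl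

theorem occ_singleton {a : A} {x : ℤ → A} {i : ℤ} : Occ [a] x i ↔ x i = a := by
  simp [Occ, fac_one]

/-! ### Counting factors -/

/-- The factors of length `q` of `x` at positions in `I`. -/
def facs (x : ℤ → A) (I : Set ℤ) (q : ℕ) : Set (List A) := (fun i => fac x i q) '' I

/-- The number of factors of length `q`. -/
noncomputable def numFac (x : ℤ → A) (q : ℕ) : ℕ := (facs x Set.univ q).ncard

theorem facs_finite [Finite A] (x : ℤ → A) (I : Set ℤ) (q : ℕ) : (facs x I q).Finite := by
  refine (List.finite_length_eq A q).subset ?_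
  rintro _ ⟨i, -, rfl⟩
  simp

theorem exists_occurrence_choice (x : ℤ → A) (I : Set ℤ) (q : ℕ) :
    ∃ f : List A → ℤ, ∀ w ∈ facs x I q, f w ∈ I ∧ fac x (f w) q = w := by
  classical
  refine ⟨fun w => if h : w ∈ facs x I q then h.choose else 0, fun w hw => ?_⟩
  simp only [hw, dif_pos]
  exact hw.choose_spec

/-- Extending each word at its chosen occurrence injects the words of length `q` into those of
length `q + 1`. Positions in `J` are continued by another letter, so the words they give are new. -/
theorem ncard_facs_add_le [Finite A] {x : ℤ → A} {I : Set ℤ} {q : ℕ} {f : List A → ℤ}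
    (hf : ∀ w ∈ facs x I q, f w ∈ I ∧ fac x (f w) q = w) (J : Set ℤ) (hJ : J ⊆ I)
    (hJf : ∀ i ∈ J, x (i + q) ≠ x (f (fac x i q) + q)) :
    (facs x I q).ncard + (facs x J (q + 1)).ncard ≤ (facs x I (q + 1)).ncard := by
  have hinj : Set.InjOn (fun w => fac x (f w) (q + 1)) (facs x I q) := by
    intro w hw w' hw' h
    simp only [fac_succ] at h
    have := (List.append_inj h (by simp)).1
    rw [(hf w hw).2, (hf w' hw').2] at this
    exact this
  rw [← hinj.ncard_image, ← Set.ncard_union_eq ?_ ((facs_finite _ _ _).image _)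
    (facs_finite _ _ _)]
  · refine Set.ncard_le_ncard ?_ (facs_finite _ _ _)
    rintro _ (⟨w, hw, rfl⟩ | ⟨i, hi, rfl⟩)
    · exact ⟨f w, (hf w hw).1, rfl⟩
    · exact ⟨i, hJ hi, rfl⟩
  · rw [Set.disjoint_left]
    rintro _ ⟨w, hw, rfl⟩ ⟨i, hi, h⟩
    simp only [fac_succ] at h
    obtain ⟨h1, h2⟩ := List.append_inj h (by simp)
    rw [(hf w hw).2] at h1
    apply hJf i hi
    rw [h1]
    simpa using h2

/-- A word is right-special in `x` if it occurs followed by two different letters. -/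
def RightSpecial (x : ℤ → A) (w : List A) : Prop :=
  ∃ i j : ℤ, fac x i w.length = w ∧ fac x j w.length = w ∧ x (i + w.length) ≠ x (j + w.length)

theorem ncard_facs_add_card_le [Finite A] {x : ℤ → A} {I : Set ℤ} {q : ℕ} (T : Finset (List A))
    (hT : ∀ w ∈ T, ∃ i ∈ I, ∃ j ∈ I, fac x i q = w ∧ fac x j q = w ∧ x (i + q) ≠ x (j + q)) :
    (facs x I q).ncard + T.card ≤ (facs x I (q + 1)).ncard := by
  obtain ⟨f, hf⟩ := exists_occurrence_choice x I q
  refine le_trans ?_ (ncard_facs_add_le hf {i | i ∈ I ∧ x (i + q) ≠ x (f (fac x i q) + q)}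
    (fun i hi => hi.1) (fun i hi => hi.2))
  gcongr
  rw [← Set.ncard_coe_finset]
  refine le_trans (Set.ncard_le_ncard (t := (fun w => w.take q) ''
    (facs x {i | i ∈ I ∧ x (i + q) ≠ x (f (fac x i q) + q)} (q + 1))) ?_
    ((facs_finite _ _ _).image _)) (Set.ncard_image_le (facs_finite _ _ _))
  intro w hw
  obtain ⟨i, hi, j, hj, h1, h2, h3⟩ := hT w hw
  by_cases h : x (i + q) = x (f w + q)
  · refine ⟨_, ⟨j, ⟨hj, ?_⟩, rfl⟩, ?_⟩
    · rw [h2, ← h]; exact h3.symm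
    · simp [fac_succ, ← h2]
  · refine ⟨_, ⟨i, ⟨hi, ?_⟩, rfl⟩, ?_⟩
    · rw [h1]; exact h
    · simp [fac_succ, ← h1]

theorem numFac_add_card_le [Finite A] {x : ℤ → A} {q : ℕ} (T : Finset (List A))
    (hT : ∀ w ∈ T, w.length = q ∧ RightSpecial x w) :
    numFac x q + T.card ≤ numFac x (q + 1) := by
  refine ncard_facs_add_card_le T fun w hw => ?_
  obtain ⟨rfl, i, j, h⟩ := hT w hw
  exact ⟨i, trivial, j, trivial, h⟩

/-- If the number of factors grows by one, the letter following a factor is determined up to a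
single exception. -/
theorem exists_unique_exception [Finite A] {x : ℤ → A} {q : ℕ}
    (h : numFac x (q + 1) ≤ numFac x q + 1) :
    ∃ f : List A → ℤ, ∀ i j : ℤ, x (i + q) ≠ x (f (fac x i q) + q) →
      x (j + q) ≠ x (f (fac x j q) + q) → fac x i (q + 1) = fac x j (q + 1) := by
  obtain ⟨f, hf⟩ := exists_occurrence_choice x Set.univ q
  refine ⟨f, fun i j hi hj => ?_⟩
  have h1 := ncard_facs_add_le hf {i | x (i + q) ≠ x (f (fac x i q) + q)}
    (fun i hi => trivial) (fun i hi => hi)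
  have h2 : (facs x {i | x (i + q) ≠ x (f (fac x i q) + q)} (q + 1)).ncard ≤ 1 := by
    unfold numFac at h; omega
  exact (Set.ncard_le_one (facs_finite _ _ _)).1 h2 _ ⟨i, hi, rfl⟩ _ ⟨j, hj, rfl⟩

/-! ### Eventual periodicity and recurrence -/

/-- `x` is eventually periodic to the right. -/
def RightPeriodic (x : ℤ → A) : Prop := ∃ p : ℤ, 0 < p ∧ ∃ N : ℤ, ∀ i, N ≤ i → x (i + p) = x i

/-- `x` is eventually periodic to the left. -/
def LeftPeriodic (x : ℤ → A) : Prop := ∃ p : ℤ, 0 < p ∧ ∃ N : ℤ, ∀ i, i ≤ N → x (i - p) = x i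

/-- By pigeonhole some factor of length `q` repeats, and determinism propagates the coincidence to
the right. -/
theorem rightPeriodic_of_deterministic [Finite A] {x : ℤ → A} {N : ℤ} {q : ℕ}
    (h : ∀ i j, N ≤ i → N ≤ j → fac x i q = fac x j q → x (i + q) = x (j + q)) :
    RightPeriodic x := by
  have hfin : (Set.range fun k : ℕ => fac x (N + k) q).Finite := by
    refine (facs_finite x Set.univ q).subset ?_
    rintro _ ⟨k, rfl⟩
    exact ⟨N + k, trivial, rfl⟩
  obtain ⟨k, l, hkl, hw⟩ : ∃ k l : ℕ, k < l ∧ fac x (N + k) q = fac x (N + l) q := by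
    have : ¬ Function.Injective fun k : ℕ => fac x (N + k) q :=
      fun hi => Set.infinite_range_of_injective hi hfin
    simp only [Function.Injective, not_forall] at this
    obtain ⟨k, l, h1, h2⟩ := this
    rcases lt_or_gt_of_ne h2 with h3 | h3
    · exact ⟨k, l, h3, h1⟩
    · exact ⟨l, k, h3, h1.symm⟩
  have key : ∀ t : ℕ, fac x (N + k + t) (q + 1) = fac x (N + l + t) (q + 1) := by
    intro t
    induction t with
    | zero =>
      rw [fac_succ, fac_succ]
      simp only [Nat.cast_zero, add_zero]
      rw [hw, h _ _ (by omega) (by omega) hw]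
    | succ t ih =>
      have h1 := fac_eq_sub ih 1 (by omega) q (by push_cast; omega)
      push_cast
      rw [← add_assoc, ← add_assoc, fac_succ, fac_succ, h1, h _ _ (by omega) (by omega) h1]
  refine ⟨l - k, by omega, N + k, fun i hi => ?_⟩
  have := fac_eq_apply (key (i - (N + k)).toNat) 0 le_rfl (by omega)
  rw [show i + ((l : ℤ) - k) = N + l + ((i - (N + k)).toNat : ℤ) + 0 by omega, ← this]
  congr 1
  omega

/-- One-sided form of the Morse–Hedlund bound, counting only factors to the right of `N`. -/
theorem lt_ncard_facs_Ici [Finite A] {x : ℤ → A} (h : ¬ RightPeriodic x) (N : ℤ) (q : ℕ) :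
    q < (facs x (Set.Ici N) q).ncard := by
  induction q with
  | zero =>
    rw [Set.ncard_pos (facs_finite _ _ _)]
    exact ⟨_, N, Set.self_mem_Ici, rfl⟩
  | succ q ih =>
    have : ∃ i j, N ≤ i ∧ N ≤ j ∧ fac x i q = fac x j q ∧ x (i + q) ≠ x (j + q) := by
      by_contra hc
      push Not at hc
      exact h (rightPeriodic_of_deterministic hc)
    obtain ⟨i, j, hi, hj, h1, h2⟩ := this
    have := ncard_facs_add_card_le (x := x) (I := Set.Ici N) (q := q) {fac x i q} (by
      intro w hw
      rw [Finset.mem_singleton] at hw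
      subst hw
      exact ⟨i, hi, j, hj, rfl, h1.symm, h2⟩)
    simp at this
    omega

theorem exists_rightSpecial [Finite A] {x : ℤ → A} (h : ¬ RightPeriodic x) (q : ℕ) :
    ∃ w, w.length = q ∧ RightSpecial x w := by
  by_contra hc
  push Not at hc
  refine h (rightPeriodic_of_deterministic (N := 0) (q := q) fun i j _ _ hw => ?_)
  by_contra hne
  exact hc (fac x i q) (by simp) ⟨i, j, by simp, by simpa using hw.symm, by simpa using hne⟩

/-- If the factor had a last occurrence `t`, the windows of length `q` covering it would give `q -
r` distinct words, none occurring to the right of `t`. Together with the more than `q` words found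
there, this makes the complexity nearly `2 * q`. -/
theorem exists_fac_eq_ge [Finite A] {x : ℤ → A} (h : ¬ RightPeriodic x) {q₀ : ℕ}
    (hb : ∀ q, q₀ ≤ q → 3 * numFac x q < 4 * q) (i : ℤ) (r : ℕ) (N : ℤ) :
    ∃ j, N ≤ j ∧ fac x j r = fac x i r := by
  by_contra hc
  push Not at hc
  obtain ⟨t, ht, hmax⟩ := Int.exists_greatest_of_bdd (P := fun j => fac x j r = fac x i r)
    ⟨N, fun j hj => by by_contra hlt; exact hc j (by omega) hj⟩ ⟨i, rfl⟩
  have key : ∀ d : ℕ, ∀ q : ℕ, d + r ≤ q → ∀ j, t < j + d → fac x j q ≠ fac x (t - d) q := by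
    intro d q hd j hj he
    have h1 := fac_eq_sub he d (by omega) r (by omega)
    rw [sub_add_cancel, ht] at h1
    have := hmax _ h1
    omega
  set q := q₀ + 3 * r + 1 with hq
  have h1 := lt_ncard_facs_Ici h (t + 1) q
  set S : Set (List A) := (fun d : ℕ => fac x (t - d) q) '' (Set.Iio (q - r)) with hS
  have hSc : S.ncard = q - r := by
    rw [hS, Set.InjOn.ncard_image]
    · rw [Set.ncard_eq_toFinset_card']; simp
    · intro d hd d' hd' he
      simp only [Set.mem_Iio] at hd hd'
      by_contra hne
      rcases lt_or_gt_of_ne hne with hlt | hlt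
      · exact key d' q (by omega) (t - d) (by omega) he
      · exact key d q (by omega) (t - d') (by omega) he.symm
  have hSf : S.Finite := (Set.finite_Iio _).image _
  have hdisj : Disjoint (facs x (Set.Ici (t + 1)) q) S := by
    rw [Set.disjoint_left]
    rintro _ ⟨j, hj, rfl⟩ ⟨d, hd, he⟩
    simp only [Set.mem_Iio, Set.mem_Ici] at hd hj
    exact key d q (by omega) j (by omega) he.symm
  have h2 := Set.ncard_union_eq hdisj (facs_finite _ _ _) hSf
  have h3 : (facs x (Set.Ici (t + 1)) q ∪ S).ncard ≤ numFac x q := by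
    refine Set.ncard_le_ncard ?_ (facs_finite _ _ _)
    rintro _ (⟨j, -, rfl⟩ | ⟨d, -, rfl⟩)
    · exact ⟨j, trivial, rfl⟩
    · exact ⟨_, trivial, rfl⟩
  have h4 := hb q (by omega)
  omega

/-- The mirror image of a sequence. -/
def mirror (x : ℤ → A) : ℤ → A := fun i => x (-i)

theorem fac_mirror (x : ℤ → A) (i : ℤ) (q : ℕ) :
    fac (mirror x) i q = (fac x (1 - i - q) q).reverse := by
  apply List.ext_getElem
  · simp
  · intro k h1 h2
    simp only [length_fac] at h1
    rw [List.getElem_reverse, getElem_fac, getElem_fac]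
    simp only [mirror, length_fac]
    congr 1
    omega

theorem numFac_mirror (x : ℤ → A) (q : ℕ) : numFac (mirror x) q = numFac x q := by
  have : facs (mirror x) Set.univ q = List.reverse '' (facs x Set.univ q) := by
    ext w
    constructor
    · rintro ⟨i, -, rfl⟩
      exact ⟨_, ⟨1 - i - q, trivial, rfl⟩, (fac_mirror x i q).symm⟩
    · rintro ⟨_, ⟨i, -, rfl⟩, rfl⟩
      refine ⟨1 - i - q, trivial, ?_⟩
      simp only [fac_mirror]
      congr 2
      ring
  rw [numFac, this, Set.InjOn.ncard_image (List.reverse_injective.injOn), numFac]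

theorem leftPeriodic_of_mirror {x : ℤ → A} (h : RightPeriodic (mirror x)) : LeftPeriodic x := by
  obtain ⟨p, hp, N, hN⟩ := h
  refine ⟨p, hp, -N, fun i hi => ?_⟩
  have := hN (-i) (by omega)
  simp only [mirror, neg_neg] at this
  rw [← this]
  congr 1
  ring

theorem exists_fac_eq_le [Finite A] {x : ℤ → A} (h : ¬ LeftPeriodic x) {q₀ : ℕ}
    (hb : ∀ q, q₀ ≤ q → 3 * numFac x q < 4 * q) (i : ℤ) (r : ℕ) (N : ℤ) :
    ∃ j, j ≤ N ∧ fac x j r = fac x i r := by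
  obtain ⟨j, hj, he⟩ := exists_fac_eq_ge (x := mirror x) (fun h' => h (leftPeriodic_of_mirror h'))
    (q₀ := q₀) (by simpa [numFac_mirror] using hb) (1 - i - r) r (1 - N - r)
  rw [fac_mirror, fac_mirror, List.reverse_inj] at he
  refine ⟨1 - j - r, by omega, ?_⟩
  rw [he]
  congr 1
  ring

end LowComplexity

namespace LowComplexity

variable {A : Type*}

/-! ### Closures and recurrence -/

theorem isOpen_setOf_fac_eq [TopologicalSpace A] [DiscreteTopology A] (w : List A) (j : ℤ) (q : ℕ) :
    IsOpen {y : ℤ → A | fac y j q = w} := by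
  by_cases hw : w.length = q
  · have : {y : ℤ → A | fac y j q = w} =
        ⋂ k : Fin q, (fun y : ℤ → A => y (j + (k : ℕ))) ⁻¹' {w[(k : ℕ)]'(by omega)} := by
      ext y
      subst hw
      simp only [Set.mem_ofPred_eq, Set.mem_iInter, Set.mem_preimage, Set.mem_singleton_iff]
      rw [show (fac y j w.length = w) = Occ w y j from rfl, occ_iff_getElem]
      exact ⟨fun h k => h k k.2, fun h k hk => h ⟨k, hk⟩⟩
    rw [this]
    exact isOpen_iInter_of_finite fun k =>
      (isOpen_discrete _).preimage (continuous_apply _)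
  · have : {y : ℤ → A | fac y j q = w} = ∅ := by
      ext y
      simp only [Set.mem_ofPred_eq, Set.mem_empty_iff_false, iff_false]
      rintro rfl
      simp at hw
    rw [this]
    exact isOpen_empty

theorem isClosed_setOf_fac_eq [TopologicalSpace A] [DiscreteTopology A] (w : List A) (j : ℤ)
    (q : ℕ) : IsClosed {y : ℤ → A | fac y j q = w} := by
  have : {y : ℤ → A | fac y j q = w}ᶜ = ⋃ v ∈ {v : List A | v ≠ w}, {y | fac y j q = v} := by
    ext y
    simp
  rw [← isOpen_compl_iff, this]
  exact isOpen_biUnion fun v _ => isOpen_setOf_fac_eq v j q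

theorem mem_closure_iff_fac [TopologicalSpace A] [DiscreteTopology A] {S : Set (ℤ → A)}
    {y : ℤ → A} : y ∈ closure S ↔ ∀ i q, ∃ s ∈ S, fac s i q = fac y i q := by
  constructor
  · intro h i q
    obtain ⟨s, hs1, hs2⟩ := mem_closure_iff.1 h _ (isOpen_setOf_fac_eq (fac y i q) i q) rfl
    exact ⟨s, hs2, hs1⟩
  · intro h
    rw [mem_closure_iff]
    intro o ho hy
    rw [isOpen_pi_iff] at ho
    obtain ⟨I, u, hu, hsub⟩ := ho y hy
    obtain ⟨N, hN⟩ : ∃ N : ℕ, ∀ i ∈ I, i.natAbs ≤ N :=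
      ⟨I.sup Int.natAbs, fun i hi => Finset.le_sup hi⟩
    obtain ⟨s, hs, he⟩ := h (-N) (2 * N + 1)
    refine ⟨s, hsub ?_, hs⟩
    intro i hi
    have h1 := hN i hi
    have := fac_eq_apply he (i + N) (by omega) (by push_cast; omega)
    rw [show -(N : ℤ) + (i + N) = i by ring] at this
    rw [this]
    exact (hu i hi).2

theorem fac_orbit {x : ℤ → A} {w : List A} {i : ℤ} :
    (∃ s ∈ orbit x, fac s i w.length = w) ↔ ∃ j, fac x j w.length = w := by
  constructor
  · rintro ⟨s, ⟨d, hd⟩, he⟩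
    refine ⟨i + d, ?_⟩
    conv_rhs => rw [← he]
    rw [fac_eq_iff]
    intro k _
    rw [hd]
    congr 1
    ring
  · rintro ⟨j, hj⟩
    refine ⟨fun t => x (t + (j - i)), ⟨j - i, fun t => rfl⟩, ?_⟩
    conv_rhs => rw [← hj]
    rw [fac_eq_iff]
    intro k _
    congr 1
    ring

theorem mem_closure_orbit_iff [TopologicalSpace A] [DiscreteTopology A] {x y : ℤ → A} :
    y ∈ closure (orbit x) ↔ ∀ i q, ∃ j, fac x j q = fac y i q := by
  rw [mem_closure_iff_fac]
  refine forall_congr' fun i => forall_congr' fun q => ?_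
  have := fac_orbit (x := x) (w := fac y i q) (i := i)
  rwa [length_fac] at this

theorem self_mem_orbit (x : ℤ → A) : x ∈ orbit x := ⟨0, by simp⟩

/-- A point in an orbit closure all of whose factors recur generates the same orbit closure. -/
theorem closure_orbit_eq [TopologicalSpace A] [DiscreteTopology A] {x y : ℤ → A}
    (hy : y ∈ closure (orbit x)) (h : ∀ i q, ∃ j, fac y j q = fac x i q) :
    closure (orbit y) = closure (orbit x) := by
  rw [mem_closure_orbit_iff] at hy
  ext z
  simp only [mem_closure_orbit_iff]
  constructor
  · intro hz i q
    obtain ⟨j, hj⟩ := hz i q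
    obtain ⟨k, hk⟩ := hy j q
    exact ⟨k, hk.trans hj⟩
  · intro hz i q
    obtain ⟨j, hj⟩ := hz i q
    obtain ⟨k, hk⟩ := h j q
    exact ⟨k, hk.trans hj⟩

theorem mem_language_iff [TopologicalSpace A] [DiscreteTopology A] {x : ℤ → A} {w : List A} :
    w ∈ language (closure (orbit x)) ↔ ∃ i, Occ w x i := by
  constructor
  · rintro ⟨y, hy, i, hi⟩
    rw [← occ_iff_occursAt] at hi
    rw [mem_closure_orbit_iff] at hy
    obtain ⟨j, hj⟩ := hy i w.length
    exact ⟨j, hj.trans hi⟩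
  · rintro ⟨i, hi⟩
    exact ⟨x, subset_closure (self_mem_orbit x), i, occ_iff_occursAt.1 hi⟩

theorem complexity_closure_orbit [TopologicalSpace A] [DiscreteTopology A] (x : ℤ → A) (q : ℕ) :
    complexity (closure (orbit x)) q = numFac x q := by
  unfold complexity numFac
  congr 1
  ext w
  simp only [Set.mem_ofPred_eq, mem_language_iff, facs, Set.image_univ, Set.mem_range]
  constructor
  · rintro ⟨⟨i, hi⟩, rfl⟩
    exact ⟨i, hi⟩
  · rintro ⟨i, rfl⟩
    exact ⟨⟨i, occ_fac x i q⟩, by simp⟩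

/-- Every factor of `x` recurs arbitrarily far to the right and to the left. -/
def BiRecurrent (x : ℤ → A) : Prop :=
  ∀ i q N, (∃ j, N ≤ j ∧ fac x j q = fac x i q) ∧ ∃ j, j ≤ N ∧ fac x j q = fac x i q

/-- Baire category in the compact space `X`: for each factor and each bound, the points showing the
factor beyond the bound on a given side form an open set, dense by the hypothesis. A point in the
countable intersection is the generator sought. -/
theorem exists_biRecurrent [Finite A] [TopologicalSpace A] [DiscreteTopology A] {x : ℤ → A}
    (h : ∀ i q i' q' N, ∃ j j', j + N ≤ j' ∧ fac x j q = fac x i q ∧ fac x j' q' = fac x i' q') :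
    ∃ y, closure (orbit y) = closure (orbit x) ∧ BiRecurrent y := by
  set X := closure (orbit x) with hX
  have hXc : IsCompact X := isClosed_closure.isCompact
  have : CompactSpace X := isCompact_iff_compactSpace.1 hXc
  have : Nonempty X := ⟨⟨x, subset_closure (self_mem_orbit x)⟩⟩
  let OR : ℤ × ℕ × ℤ → Set X := fun p => {y | ∃ j, p.2.2 ≤ j ∧ fac y.1 j p.2.1 = fac x p.1 p.2.1}
  let OL : ℤ × ℕ × ℤ → Set X := fun p => {y | ∃ j, j ≤ p.2.2 ∧ fac y.1 j p.2.1 = fac x p.1 p.2.1}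
  have openR : ∀ p, IsOpen (OR p) := by
    intro p
    have : OR p = ⋃ j ∈ Set.Ici p.2.2,
        Subtype.val ⁻¹' {y : ℤ → A | fac y j p.2.1 = fac x p.1 p.2.1} := by
      ext y; simp [OR]
    rw [this]
    exact isOpen_biUnion fun j _ => (isOpen_setOf_fac_eq _ _ _).preimage continuous_subtype_val
  have openL : ∀ p, IsOpen (OL p) := by
    intro p
    have : OL p = ⋃ j ∈ Set.Iic p.2.2,
        Subtype.val ⁻¹' {y : ℤ → A | fac y j p.2.1 = fac x p.1 p.2.1} := by
      ext y; simp [OL]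
    rw [this]
    exact isOpen_biUnion fun j _ => (isOpen_setOf_fac_eq _ _ _).preimage continuous_subtype_val
  have approx : ∀ (y : ℤ → A) (a b i : ℤ) (q r : ℕ), fac x a r = fac y i r →
      ∃ z ∈ X, fac z i r = fac y i r ∧ fac z (i + (b - a)) q = fac x b q := by
    intro y a b i q r he
    refine ⟨fun t => x (t + (a - i)), subset_closure ⟨a - i, fun t => rfl⟩, ?_, ?_⟩
    · rw [← he, fac_eq_iff]
      intro k _
      congr 1
      ring
    · rw [fac_eq_iff]
      intro k _
      congr 1
      ring
  have denseR : ∀ p, Dense (OR p) := by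
    rintro ⟨i', q', N⟩
    rw [Subtype.dense_iff]
    intro y hy
    rw [mem_closure_iff_fac]
    intro i q
    obtain ⟨k, hk⟩ := mem_closure_orbit_iff.1 hy i q
    obtain ⟨j, j', hjj, h1, h2⟩ := h k q i' q' (N - i)
    obtain ⟨z, hz, h3, h4⟩ := approx y j j' i q' q (h1.trans hk)
    exact ⟨z, ⟨⟨z, hz⟩, ⟨_, by dsimp only; omega, h4.trans h2⟩, rfl⟩, h3⟩
  have denseL : ∀ p, Dense (OL p) := by
    rintro ⟨i', q', N⟩
    rw [Subtype.dense_iff]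
    intro y hy
    rw [mem_closure_iff_fac]
    intro i q
    obtain ⟨k, hk⟩ := mem_closure_orbit_iff.1 hy i q
    obtain ⟨j', j, hjj, h2, h1⟩ := h i' q' k q (i - N)
    obtain ⟨z, hz, h3, h4⟩ := approx y j j' i q' q (h1.trans hk)
    exact ⟨z, ⟨⟨z, hz⟩, ⟨_, by dsimp only; omega, h4.trans h2⟩, rfl⟩, h3⟩
  have hd : Dense (⋂ p, OR p ∩ OL p) :=
    dense_iInter_of_isOpen (fun p => (openR p).inter (openL p)) fun p =>
      (denseR p).inter_of_isOpen_left (denseL p) (openR p)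
  obtain ⟨y, hy⟩ := hd.nonempty
  rw [Set.mem_iInter] at hy
  refine ⟨y.1, closure_orbit_eq y.2 fun i q => ?_, ?_⟩
  · obtain ⟨j, -, hj⟩ := (hy (i, q, 0)).1
    exact ⟨j, hj⟩
  · intro i q N
    obtain ⟨k, hk⟩ := mem_closure_orbit_iff.1 y.2 i q
    obtain ⟨⟨j, hj, h1⟩, ⟨j', hj', h2⟩⟩ := hy (k, q, N)
    exact ⟨⟨j, hj, h1.trans hk⟩, ⟨j', hj', h2.trans hk⟩⟩

theorem finite_closure_orbit_of_periodic [TopologicalSpace A] [DiscreteTopology A] {x : ℤ → A}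
    {p : ℤ} (hp : 0 < p) (h : ∀ i, x (i + p) = x i) : (closure (orbit x)).Finite := by
  have hmul : ∀ k : ℕ, ∀ i, x (i + k * p) = x i := by
    intro k
    induction k with
    | zero => simp
    | succ k ih =>
      intro i
      rw [← ih i, ← h (i + k * p)]
      congr 1
      push_cast
      ring
  have hmulz : ∀ k i : ℤ, x (i + k * p) = x i := by
    intro k i
    obtain ⟨n, rfl | rfl⟩ := k.eq_nat_or_neg
    · exact hmul n i
    · rw [← hmul n]
      congr 1
      ring
  have hfin : (orbit x).Finite := by
    refine ((Set.finite_Ico (0 : ℤ) p).image fun j => fun i => x (i + j)).subset ?_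
    rintro z ⟨j, hj⟩
    refine ⟨j % p, ⟨Int.emod_nonneg _ hp.ne', Int.emod_lt_of_pos _ hp⟩, ?_⟩
    ext i
    simp only
    rw [hj, ← hmulz (j / p)]
    congr 1
    have := Int.emod_add_mul_ediv j p
    linarith
  rw [hfin.isClosed.closure_eq]
  exact hfin

/-- Recurrence moves any window into the eventually periodic part, so `x` would be periodic and its
orbit finite. -/
theorem BiRecurrent.not_rightPeriodic [TopologicalSpace A] [DiscreteTopology A] {x : ℤ → A}
    (hx : BiRecurrent x) (hinf : (closure (orbit x)).Infinite) : ¬ RightPeriodic x := by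
  rintro ⟨p, hp, N, hN⟩
  refine hinf (finite_closure_orbit_of_periodic hp fun i => ?_)
  obtain ⟨j, hj, he⟩ := (hx i (p.toNat + 1) N).1
  have h1 := fac_eq_apply he p (by omega) (by push_cast; omega)
  have h2 := fac_eq_apply he 0 (by omega) (by push_cast; omega)
  simp only [add_zero] at h2
  rw [← h1, hN j hj, h2]

theorem BiRecurrent.not_leftPeriodic [TopologicalSpace A] [DiscreteTopology A] {x : ℤ → A}
    (hx : BiRecurrent x) (hinf : (closure (orbit x)).Infinite) : ¬ LeftPeriodic x := by
  rintro ⟨p, hp, N, hN⟩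
  refine hinf (finite_closure_orbit_of_periodic hp fun i => ?_)
  obtain ⟨j, hj, he⟩ := (hx i (p.toNat + 1) (N - p)).2
  have h1 := fac_eq_apply he p (by omega) (by push_cast; omega)
  have h2 := fac_eq_apply he 0 (by omega) (by push_cast; omega)
  simp only [add_zero] at h2
  rw [← h1, ← h2, ← hN (j + p) (by omega)]
  congr 1
  ring

theorem exists_numFac_lt [TopologicalSpace A] [DiscreteTopology A] {x : ℤ → A}
    (hlim : Filter.limsup (fun q : ℕ => (complexity (closure (orbit x)) q : ENNReal) / (q : ENNReal))
      Filter.atTop < 4 / 3) : ∃ q₀ : ℕ, ∀ q, q₀ ≤ q → 3 * numFac x q < 4 * q := by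
  have h1 := Filter.eventually_lt_of_limsup_lt hlim
  rw [Filter.eventually_atTop] at h1
  obtain ⟨N, hN⟩ := h1
  refine ⟨N + 1, fun q hq => ?_⟩
  have h2 := hN q (by omega)
  rw [complexity_closure_orbit] at h2
  have hq0 : (q : ENNReal) ≠ 0 := by
    rw [Nat.cast_ne_zero]; omega
  rw [ENNReal.div_lt_iff (Or.inl hq0) (Or.inl (ENNReal.natCast_ne_top q))] at h2
  have h3 := ENNReal.toReal_strict_mono (by
    exact ENNReal.mul_ne_top (ENNReal.div_ne_top (by norm_num) (by norm_num))
      (ENNReal.natCast_ne_top q)) h2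
  simp only [ENNReal.toReal_natCast, ENNReal.toReal_mul, ENNReal.toReal_div,
    ENNReal.toReal_ofNat] at h3
  have h4 : (3 * numFac x q : ℝ) < 4 * q := by linarith
  exact_mod_cast h4

/-- A transitive subshift of low complexity which is not the orbit closure of a sequence eventually
periodic on both sides is the orbit closure of a recurrent, non-periodic sequence. -/
theorem exists_recurrent_generator [Finite A] [TopologicalSpace A] [DiscreteTopology A]
    {X : Set (ℤ → A)} (hinf : X.Infinite) (htrans : IsTransitive X)
    (hper : ¬ ∃ x : ℤ → A, EventuallyPeriodicBothSides x ∧ X = closure (orbit x))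
    (hlim : Filter.limsup (fun q : ℕ => (complexity X q : ENNReal) / (q : ENNReal))
      Filter.atTop < 4 / 3) :
    ∃ x, X = closure (orbit x) ∧ BiRecurrent x ∧ ¬ RightPeriodic x ∧ ¬ LeftPeriodic x ∧
      ∃ q₀ : ℕ, ∀ q, q₀ ≤ q → 3 * numFac x q < 4 * q := by
  obtain ⟨x, -, rfl⟩ := htrans
  obtain ⟨q₀, hb⟩ := exists_numFac_lt hlim
  have hx : ¬ (RightPeriodic x ∧ LeftPeriodic x) := fun h => hper ⟨x, h, rfl⟩
  have key : ∀ i q i' q' N, ∃ j j', j + N ≤ j' ∧ fac x j q = fac x i q ∧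
      fac x j' q' = fac x i' q' := by
    intro i q i' q' N
    -- At least one side is not eventually periodic; on that side one of the two factors can be
    -- pushed as far out as needed.
    by_cases hr : RightPeriodic x
    · obtain ⟨j, hj, he⟩ := exists_fac_eq_le (fun hl => hx ⟨hr, hl⟩) hb i q (i' - N)
      exact ⟨j, i', by omega, he, rfl⟩
    · obtain ⟨j, hj, he⟩ := exists_fac_eq_ge hr hb i' q' (i + N)
      exact ⟨i, j, hj, rfl, he⟩
  obtain ⟨y, hy, hrec⟩ := exists_biRecurrent key
  rw [← hy] at hinf hlim
  exact ⟨y, hy.symm, hrec, hrec.not_rightPeriodic hinf, hrec.not_leftPeriodic hinf,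
    exists_numFac_lt hlim⟩

end LowComplexity

namespace LowComplexity

variable {A B C : Type*}

/-! ### Substitutions and codings -/

@[simp] theorem applyWord_nil (π : B → List C) : applyWord π [] = [] := rfl

@[simp] theorem applyWord_append (π : B → List C) (u v : List B) :
    applyWord π (u ++ v) = applyWord π u ++ applyWord π v := by
  simp [applyWord]

@[simp] theorem applyWord_cons (π : B → List C) (a : B) (v : List B) :
    applyWord π (a :: v) = π a ++ applyWord π v := by
  simp [applyWord]

theorem applyWord_applyWord {D : Type*} (π : C → List D) (τ : B → List C) (w : List B) :
    applyWord π (applyWord τ w) = applyWord (fun b => applyWord π (τ b)) w := by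
  simp [applyWord, List.flatMap_assoc]

@[simp] theorem length_applyWord_replicate (π : B → List C) (k : ℕ) (b : B) :
    (applyWord π (List.replicate k b)).length = k * (π b).length := by
  induction k with
  | zero => simp
  | succ k ih => rw [List.replicate_succ, applyWord_cons, List.length_append, ih]; ring

theorem length_le_length_applyWord {π : B → List C} (hπ : ∀ b, π b ≠ []) (w : List B) :
    w.length ≤ (applyWord π w).length := by
  induction w with
  | nil => simp
  | cons a w ih =>
    have := List.length_pos_iff.2 (hπ a)
    simp only [applyWord_cons, List.length_append, List.length_cons]
    omega

theorem Occ.of_suffix {v w : List A} {x : ℤ → A} {p : ℤ} (h : Occ w x (p - w.length))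
    (hs : v <:+ w) : Occ v x (p - v.length) := by
  obtain ⟨u, rfl⟩ := hs
  rw [occ_append] at h
  convert h.2 using 1
  simp only [List.length_append]
  push_cast
  ring

theorem Occ.of_infix {u v w : List A} {x : ℤ → A} {i : ℤ} (h : Occ (u ++ v ++ w) x i) :
    Occ v x (i + u.length) := by
  rw [occ_append, occ_append] at h
  exact h.1.2

theorem Occ.fac_eq {w : List A} {x : ℤ → A} {i j : ℤ} (hi : Occ w x i) (hj : Occ w x j) :
    fac x i w.length = fac x j w.length := Eq.trans hi (Eq.symm hj)

/-- The sequence `x` is the concatenation of the blocks `π (z i)`, the block of index `i` starting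
at position `e i`. -/
structure Coding (x : ℤ → A) (π : B → List A) (z : ℤ → B) (e : ℤ → ℤ) : Prop where
  occ : ∀ i, Occ (π (z i)) x (e i)
  next : ∀ i, e (i + 1) = e i + (π (z i)).length

namespace Coding

variable {x : ℤ → A} {π : B → List A} {z : ℤ → B} {e : ℤ → ℤ}

theorem occ_applyWord (h : Coding x π z e) (t : ℤ) (l : ℕ) :
    Occ (applyWord π (fac z t l)) x (e t) ∧
      e (t + l) = e t + (applyWord π (fac z t l)).length := by
  induction l with
  | zero => simp [occ_nil]
  | succ l ih =>
    have h1 := h.occ (t + l)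
    have h2 := h.next (t + l)
    rw [fac_succ, applyWord_append, occ_append, ← ih.2]
    refine ⟨⟨ih.1, by simpa using h1⟩, ?_⟩
    push_cast
    rw [← add_assoc, h2, ih.2]
    simp [add_assoc]

theorem strictMono (h : Coding x π z e) (hπ : ∀ b, π b ≠ []) : StrictMono e := by
  refine strictMono_int_of_lt_succ fun i => ?_
  have := List.length_pos_iff.2 (hπ (z i))
  rw [h.next]
  omega

end Coding

theorem add_le_of_strictMono {e : ℤ → ℤ} (he : StrictMono e) (t : ℤ) (l : ℕ) :
    e t + l ≤ e (t + l) := by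
  induction l with
  | zero => simp
  | succ l ih =>
    have : e (t + l) < e (t + (l + 1 : ℕ)) := he (by push_cast; omega)
    push_cast at *
    omega

theorem exists_block_of_strictMono {e : ℤ → ℤ} (he : StrictMono e) (i : ℤ) :
    ∃ t, e t ≤ i ∧ i < e (t + 1) := by
  obtain ⟨t, ht, hmax⟩ := Int.exists_greatest_of_bdd (P := fun t => e t ≤ i)
    ⟨(i - e 0).toNat, fun t ht => by
      by_contra hc
      have h1 := add_le_of_strictMono he 0 (i - e 0).toNat
      rw [zero_add] at h1
      have h2 := he (not_le.1 hc)
      have h3 : e ((i - e 0).toNat + 1) ≤ e t := he.monotone (by omega)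
      have h4 : e ((i - e 0).toNat) < e ((i - e 0).toNat + 1) := he (by omega)
      omega⟩
    ⟨-((e 0 - i).toNat : ℤ), by
      have h1 := add_le_of_strictMono he (-((e 0 - i).toNat : ℤ)) (e 0 - i).toNat
      rw [neg_add_cancel] at h1
      omega⟩
  refine ⟨t, ht, ?_⟩
  by_contra hc
  have := hmax (t + 1) (not_lt.1 hc)
  omega

namespace Coding

variable {x : ℤ → A} {π : B → List A} {z : ℤ → B} {e : ℤ → ℤ}

theorem head?_eq (h : Coding x π z e) (hπ : ∀ b, π b ≠ []) (t : ℤ) :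
    (π (z t)).head? = some (x (e t)) := by
  have h1 := h.occ t
  have h2 := hπ (z t)
  cases hw : π (z t) with
  | nil => exact absurd hw h2
  | cons a w =>
    rw [hw, show a :: w = [a] ++ w from rfl, occ_append, occ_singleton] at h1
    rw [h1.1]
    rfl

theorem comp {D : Type*} {σ : D → List B} {z' : ℤ → D} {g : ℤ → ℤ} (h : Coding x π z e)
    (h' : Coding z σ z' g) : Coding x (fun d => applyWord π (σ d)) z' (e ∘ g) := by
  have key : ∀ i, fac z (g i) (σ (z' i)).length = σ (z' i) := fun i => h'.occ i
  constructor
  · intro i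
    have := (h.occ_applyWord (g i) (σ (z' i)).length).1
    rwa [key] at this
  · intro i
    have := (h.occ_applyWord (g i) (σ (z' i)).length).2
    rw [key] at this
    simp only [Function.comp, h'.next, this]

theorem apply_add_length (h : Coding x π z e) {b : B} {i t : ℤ}
    (ht : e t ≤ i) (ht' : i < e (t + 1)) (h0 : z t = b) (h1 : z (t + 1) = b) :
    x (i + (π b).length) = x i := by
  have a1 := h.occ t
  have a2 := h.occ (t + 1)
  have a3 := h.next t
  rw [h0] at a1 a3
  rw [h1] at a2
  have := fac_eq_apply (a1.fac_eq a2) (i - e t) (by omega) (by omega)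
  rw [a3] at this
  rw [show i + ((π b).length : ℤ) = e t + (π b).length + (i - e t) by ring, ← this]
  congr 1
  ring

theorem rightPeriodic (h : Coding x π z e) (hπ : ∀ b, π b ≠ []) {b : B} {T : ℤ}
    (hT : ∀ t, T ≤ t → z t = b) : RightPeriodic x := by
  have hpos := List.length_pos_iff.2 (hπ b)
  refine ⟨(π b).length, by omega, e T, fun i hi => ?_⟩
  obtain ⟨t, h1, h2⟩ := exists_block_of_strictMono (h.strictMono hπ) i
  have : T ≤ t := by
    by_contra hc
    have : e (t + 1) ≤ e T := (h.strictMono hπ).monotone (by omega)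
    omega
  exact h.apply_add_length h1 h2 (hT _ this) (hT _ (by omega))

theorem leftPeriodic (h : Coding x π z e) (hπ : ∀ b, π b ≠ []) {b : B} {T : ℤ}
    (hT : ∀ t, t ≤ T → z t = b) : LeftPeriodic x := by
  have hpos := List.length_pos_iff.2 (hπ b)
  refine ⟨(π b).length, by omega, e T - 1, fun i hi => ?_⟩
  obtain ⟨t, h1, h2⟩ := exists_block_of_strictMono (h.strictMono hπ) (i - (π b).length)
  have : t + 1 ≤ T := by
    by_contra hc
    have : e T ≤ e t := (h.strictMono hπ).monotone (by omega)
    omega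
  have := h.apply_add_length h1 h2 (hT _ (by omega)) (hT _ this)
  rw [← this]
  congr 1
  ring

end Coding

/-- The elements of a set of integers unbounded in both directions can be listed in order. -/
theorem exists_strictMono_range_eq {P : ℤ → Prop} (hr : ∀ N, ∃ i, N ≤ i ∧ P i)
    (hl : ∀ N, ∃ i, i ≤ N ∧ P i) :
    ∃ g : ℤ → ℤ, StrictMono g ∧ (∀ j, P (g j)) ∧ ∀ i, P i → ∃ j, g j = i := by
  classical
  let S := {i // P i}
  have : NoMaxOrder S := ⟨fun a => by
    obtain ⟨i, hi, hP⟩ := hr (a.1 + 1)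
    exact ⟨⟨i, hP⟩, by rw [← Subtype.coe_lt_coe]; dsimp only; omega⟩⟩
  have : NoMinOrder S := ⟨fun a => by
    obtain ⟨i, hi, hP⟩ := hl (a.1 - 1)
    exact ⟨⟨i, hP⟩, by rw [← Subtype.coe_lt_coe]; dsimp only; omega⟩⟩
  have : Nonempty S := by
    obtain ⟨i, -, hP⟩ := hr 0
    exact ⟨⟨i, hP⟩⟩
  let : LocallyFiniteOrder S := inferInstanceAs (LocallyFiniteOrder (Subtype P))
  let : SuccOrder S := LinearLocallyFiniteOrder.succOrder S
  let : PredOrder S := LinearLocallyFiniteOrder.predOrder S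
  let f : S ≃o ℤ := orderIsoIntOfLinearSuccPredArch
  refine ⟨fun j => (f.symm j).1, fun a b hab => f.symm.strictMono hab, fun j => (f.symm j).2,
    fun i hi => ⟨f ⟨i, hi⟩, by simp⟩⟩

end LowComplexity

namespace LowComplexity

variable {A : Type*}

/-! ### Common suffixes of concatenations of two words -/

/-- Long concatenations of `π 0` and `π 1` have suffix `s`, which is preceded by the letter `α` if
the last block is `π 0`, and by `β` if it is `π 1`. -/
def SuffixSplit (π : Fin 2 → List A) (s : List A) (α β : A) : Prop :=
  ∃ N : ℕ, ∀ c : List (Fin 2), N ≤ c.length →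
    (α :: s) <:+ applyWord π (c ++ [0]) ∧ (β :: s) <:+ applyWord π (c ++ [1])

theorem isSuffix_append_right {u v : List A} (h : u <:+ v) (w : List A) :
    u ++ w <:+ v ++ w := by
  obtain ⟨t, rfl⟩ := h
  exact ⟨t, by simp⟩

theorem forall_fin_two_ne_nil {π : Fin 2 → List A} (h0 : π 0 ≠ []) (h1 : π 1 ≠ []) (b : Fin 2) :
    π b ≠ [] := by
  fin_cases b <;> assumption

/-- Exchanging the two words. -/
theorem SuffixSplit.swap {π : Fin 2 → List A} {s : List A} {α β : A} (h : SuffixSplit π s α β) :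
    SuffixSplit (fun a => π (a + 1)) s β α := by
  obtain ⟨N, hN⟩ := h
  have key : ∀ w : List (Fin 2), applyWord (fun a => π (a + 1)) w = applyWord π (w.map (· + 1)) := by
    intro w
    simp [applyWord, List.flatMap_map]
  refine ⟨N, fun c hc => ?_⟩
  have := hN (c.map (· + 1)) (by simpa using hc)
  rw [key, key, List.map_append, List.map_append]
  exact ⟨this.2, this.1⟩

/-- Euclid's algorithm on the two words: when `π 1 = v ++ π 0`, conjugation by `π 0` reduces the
pair to `π 0, v` and lengthens the common suffix by `π 0`. Different first letters survive and
prevent `v` from being empty. -/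
theorem exists_suffixSplit_aux (n : ℕ) (π : Fin 2 → List A) (h0 : π 0 ≠ []) (h1 : π 1 ≠ [])
    (hd : (π 0).head? ≠ (π 1).head?) (hle : (π 0).length ≤ (π 1).length)
    (hn : (π 0).length + (π 1).length = n) :
    ∃ s α β, α ≠ β ∧ SuffixSplit π s α β ∧ s.length + 2 ≤ n := by
  induction n using Nat.strong_induction_on generalizing π with
  | _ n ih =>
  have hp0 := List.length_pos_iff.2 h0
  have hp1 := List.length_pos_iff.2 h1
  by_cases hs : π 0 <:+ π 1
  · obtain ⟨v, hv⟩ := hs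
    have hv0 : v ≠ [] := by
      rintro rfl
      rw [List.nil_append] at hv
      exact hd (by rw [hv])
    have hhead : v.head? = (π 1).head? := by
      rw [← hv]
      cases v with
      | nil => exact absurd rfl hv0
      | cons a v => rfl
    have hlen : (π 1).length = v.length + (π 0).length := by rw [← hv, List.length_append]
    have hpv := List.length_pos_iff.2 hv0
    -- the pair `π 0, v`
    have main : ∃ s α β, α ≠ β ∧ SuffixSplit ![π 0, v] s α β ∧
        s.length + 2 ≤ (π 0).length + v.length := by
      rcases le_total (π 0).length v.length with hl | hl
      · exact ih _ (by omega) ![π 0, v] h0 hv0 (by simpa [hhead] using hd) (by simpa using hl) rfl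
      · obtain ⟨s, α, β, hne, hsp, hle'⟩ := ih (v.length + (π 0).length) (by omega) ![v, π 0] hv0 h0
          (by simpa [hhead] using hd.symm) (by simpa using hl) rfl
        refine ⟨s, β, α, hne.symm, ?_, by omega⟩
        convert hsp.swap using 1
        funext a
        fin_cases a <;> rfl
    obtain ⟨s, α, β, hne, ⟨N, hN⟩, hle'⟩ := main
    -- The extra block in `N + 1` ends with `π 0` and starts the conjugation.
    refine ⟨s ++ π 0, α, β, hne, ⟨N + 1, fun c hc => ?_⟩, by simp; omega⟩
    -- conjugation by `π 0`
    have conj : ∀ c : List (Fin 2), π 0 ++ applyWord π c =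
        applyWord ![π 0, v] (c.flatMap ![[0], [0, 1]]) ++ π 0 := by
      intro c
      induction c with
      | nil => simp
      | cons a c ihc =>
        have : ∀ a, π 0 ++ π a = applyWord ![π 0, v] (![[0], [0, 1]] a) ++ π 0 := by
          intro a
          fin_cases a
          · simp
          · simp [hv]
        rw [applyWord_cons, ← List.append_assoc, this, List.append_assoc, ihc]
        simp [applyWord]
    have hlong : ∀ c : List (Fin 2), c.length ≤ (c.flatMap (![[0], [0, 1]] : Fin 2 → List (Fin 2))).length :=
      length_le_length_applyWord (π := ![[0], [0, 1]]) (forall_fin_two_ne_nil (by simp) (by simp))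
    obtain ⟨b, c, rfl⟩ : ∃ b c', c = b :: c' := by
      cases c with
      | nil => simp at hc
      | cons b c => exact ⟨b, c, rfl⟩
    have hfirst : ∃ u, π b = u ++ π 0 := by
      fin_cases b
      · exact ⟨[], rfl⟩
      · exact ⟨v, hv.symm⟩
    obtain ⟨u, hu⟩ := hfirst
    have form : ∀ a, applyWord π (b :: c ++ [a]) =
        u ++ applyWord ![π 0, v] ((c ++ [a]).flatMap ![[0], [0, 1]]) ++ π 0 := by
      intro a
      rw [List.cons_append, applyWord_cons, hu, List.append_assoc, conj, List.append_assoc]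
    have hc' := hlong c
    simp only [List.length_cons] at hc
    constructor
    · rw [form, ← List.cons_append]
      refine isSuffix_append_right ?_ _
      refine List.IsSuffix.trans ?_ (List.suffix_append _ _)
      simpa using (hN (c.flatMap ![[0], [0, 1]]) (by omega)).1
    · rw [form, ← List.cons_append]
      refine isSuffix_append_right ?_ _
      refine List.IsSuffix.trans ?_ (List.suffix_append _ _)
      have := (hN (c.flatMap ![[0], [0, 1]] ++ [0]) (by rw [List.length_append]; omega)).2
      rw [List.append_assoc] at this
      simpa using this
  · -- the longest common suffix is shorter than both words
    have aux : ∀ u v : List A, u.length ≤ v.length → ¬ u <+: v →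
        ∃ s α β, α ≠ β ∧ (s ++ [α]) <+: u ∧ (s ++ [β]) <+: v := by
      intro u
      induction u with
      | nil => intro v _ h; exact absurd List.nil_prefix h
      | cons a u ihu =>
        intro v hl hnp
        cases v with
        | nil => simp at hl
        | cons b v =>
          by_cases hab : a = b
          · subst hab
            obtain ⟨s, α, β, hne, h1, h2⟩ := ihu v (by simpa using hl)
              (fun h => hnp (List.cons_prefix_cons.2 ⟨rfl, h⟩))
            exact ⟨a :: s, α, β, hne, List.cons_prefix_cons.2 ⟨rfl, h1⟩,
              List.cons_prefix_cons.2 ⟨rfl, h2⟩⟩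
          · exact ⟨[], a, b, hab, by simp, by simp⟩
    obtain ⟨s, α, β, hne, hu, hv⟩ := aux (π 0).reverse (π 1).reverse (by simpa using hle)
      (fun h => hs (List.reverse_prefix.1 h))
    refine ⟨s.reverse, α, β, hne, ⟨0, fun c _ => ⟨?_, ?_⟩⟩, ?_⟩
    · rw [applyWord_append]
      refine List.IsSuffix.trans ?_ (List.suffix_append _ _)
      rw [← List.reverse_prefix]
      simpa using hu
    · rw [applyWord_append]
      refine List.IsSuffix.trans ?_ (List.suffix_append _ _)
      rw [← List.reverse_prefix]
      simpa using hv
    · have := hu.length_le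
      simp at this ⊢
      omega

theorem exists_suffixSplit {π : Fin 2 → List A} (h0 : π 0 ≠ []) (h1 : π 1 ≠ [])
    (hd : (π 0).head? ≠ (π 1).head?) (hle : (π 0).length ≤ (π 1).length) :
    ∃ s α β, α ≠ β ∧ SuffixSplit π s α β ∧ s.length + 2 ≤ (π 0).length + (π 1).length :=
  exists_suffixSplit_aux _ π h0 h1 hd hle rfl

theorem SuffixSplit.isMaxCommonSuffix {π : Fin 2 → List A} {s : List A} {α β : A}
    (h : SuffixSplit π s α β) (hne : α ≠ β) : IsMaxCommonSuffix (π 0) (π 1) s := by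
  obtain ⟨N, hN⟩ := h
  have hpow : ∀ t, (List.replicate t (π 0)).flatten = applyWord π (List.replicate t 0) := by
    intro t
    simp [applyWord, List.flatMap]
  have h0 : ∀ t, N + 1 ≤ t → (α :: s) <:+ (List.replicate t (π 0)).flatten ++ [] := by
    intro t ht
    obtain ⟨k, rfl⟩ : ∃ k, t = k + 1 := ⟨t - 1, by omega⟩
    rw [hpow, List.append_nil, List.replicate_succ']
    exact (hN (List.replicate k 0) (by simp; omega)).1
  have h1 : ∀ t, N ≤ t → (β :: s) <:+ (List.replicate t (π 0)).flatten ++ π 1 := by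
    intro t ht
    have := (hN (List.replicate t 0) (by simp; omega)).2
    rw [hpow]
    simpa using this
  have mono : ∀ t t' u, t ≤ t' →
      (List.replicate t (π 0)).flatten ++ u <:+ (List.replicate t' (π 0)).flatten ++ u := by
    intro t t' u ht
    refine isSuffix_append_right ?_ _
    obtain ⟨d, rfl⟩ := Nat.exists_eq_add_of_le' ht
    rw [List.replicate_add, List.flatten_append]
    exact List.suffix_append _ _
  refine ⟨⟨⟨N + 1, (List.suffix_cons α s).trans (h0 _ le_rfl)⟩,
    ⟨N, (List.suffix_cons β s).trans (h1 _ le_rfl)⟩⟩, ?_⟩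
  rintro s' ⟨t, ht⟩ ⟨t', ht'⟩
  have a0 := ht.trans (mono _ (max t (N + 1)) _ (le_max_left _ _))
  have a1 := ht'.trans (mono _ (max t' N) _ (le_max_left _ _))
  have b0 := h0 _ (le_max_right t (N + 1))
  have b1 := h1 _ (le_max_right t' N)
  by_cases hl : s'.length ≤ s.length
  · exact List.suffix_of_suffix_length_le a0 ((List.suffix_cons α s).trans b0) hl
  · have c0 := List.suffix_of_suffix_length_le b0 a0 (by simp; omega)
    have c1 := List.suffix_of_suffix_length_le b1 a1 (by simp; omega)
    have := List.suffix_of_suffix_length_le c0 c1 (by simp)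
    have := this.eq_of_length (by simp)
    simp only [List.cons.injEq, and_true] at this
    exact absurd this hne

/-! ### Comparing the left contexts of two cuts -/

section Context

variable {x : ℤ → A} {π : Fin 2 → List A} {z : ℤ → Fin 2} {e : ℤ → ℤ} {s : List A} {α β : A}

theorem Coding.occ_split (h : Coding x π z e) (hs : SuffixSplit π s α β) (t : ℤ) :
    (z (t - 1) = 0 → Occ (α :: s) x (e t - (α :: s).length)) ∧
      (z (t - 1) = 1 → Occ (β :: s) x (e t - (β :: s).length)) := by
  obtain ⟨N, hN⟩ := hs
  have h1 := h.occ_applyWord (t - 1 - N) (N + 1)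
  have h2 := hN (fac z (t - 1 - N) N) (by simp)
  rw [fac_succ] at h1
  rw [show t - 1 - (N : ℤ) + N = t - 1 by ring,
    show t - 1 - (N : ℤ) + (N + 1 : ℕ) = t by push_cast; ring] at h1
  obtain ⟨h1, h3⟩ := h1
  rw [show e (t - 1 - N) = e t - (applyWord π (fac z (t - 1 - N) N ++ [z (t - 1)])).length by
    rw [h3]; ring] at h1
  constructor
  · intro hz
    rw [hz] at h1
    exact h1.of_suffix h2.1
  · intro hz
    rw [hz] at h1
    exact h1.of_suffix h2.2

theorem Coding.occ_suffix (h : Coding x π z e) (hs : SuffixSplit π s α β) (t : ℤ) :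
    Occ s x (e t - s.length) := by
  have h1 := h.occ_split hs t
  by_cases hz : z (t - 1) = 0
  · exact (h1.1 hz).of_suffix (List.suffix_cons _ _)
  · exact (h1.2 (by omega)).of_suffix (List.suffix_cons _ _)

/-- The word `c` ends at position `t` of `z`. -/
def EndsAt {B : Type*} (z : ℤ → B) (c : List B) (t : ℤ) : Prop := fac z (t - c.length) c.length = c

theorem Coding.occ_suffix_append (h : Coding x π z e) (hs : SuffixSplit π s α β) {t : ℤ}
    {c : List (Fin 2)} (hc : EndsAt z c t) :
    EndsAt x (s ++ applyWord π c) (e t) ∧ e t = e (t - c.length) + (applyWord π c).length := by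
  have h1 := h.occ_applyWord (t - c.length) c.length
  rw [sub_add_cancel, hc] at h1
  refine ⟨?_, h1.2⟩
  have h2 := h.occ_suffix hs (t - c.length)
  unfold EndsAt
  change Occ _ x _
  rw [occ_append, h1.2]
  constructor
  · convert h2 using 1
    simp
    try ring
  · convert h1.1 using 1
    simp
    try ring

/-- Cuts with a common left context in the code have a long common left context. -/
theorem Coding.fac_eq_of_endsAt (h : Coding x π z e) (hs : SuffixSplit π s α β) {t t' : ℤ}
    {c : List (Fin 2)} (hc : EndsAt z c t) (hc' : EndsAt z c t') {q : ℕ}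
    (hq : q ≤ s.length + (applyWord π c).length) : fac x (e t - q) q = fac x (e t' - q) q := by
  have h1 := (h.occ_suffix_append hs hc).1.trans (h.occ_suffix_append hs hc').1.symm
  rw [List.length_append] at h1
  have := fac_eq_sub h1 ((s.length + (applyWord π c).length : ℕ) - q) (by push_cast; omega) q
    (by push_cast; omega)
  convert this using 2 <;> ring

/-- Cuts preceded by different numbers of blocks `π 0` have a short common left context. -/
theorem Coding.length_le_of_fac_eq (h : Coding x π z e) (hs : SuffixSplit π s α β) (hne : α ≠ β)
    {t t' : ℤ} {i : ℕ} (ht : EndsAt z (1 :: List.replicate i 0) t)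
    (ht' : EndsAt z (List.replicate (i + 1) 0) t') {q : ℕ}
    (hq : fac x (e t - q) q = fac x (e t' - q) q) : q ≤ s.length + i * (π 0).length := by
  have hs' : ∀ {t b}, EndsAt z (b :: List.replicate i 0) t →
      e t = e (t - i) + (i * (π 0).length : ℕ) ∧ z (t - i - 1) = b := by
    intro t b ht
    have ht2 : z (t - i - 1) = b ∧ EndsAt z (List.replicate i 0) t := by
      unfold EndsAt at ht ⊢
      simp only [List.length_cons, List.length_replicate] at ht ⊢
      rw [fac_succ_left, List.cons.injEq] at ht
      push_cast at ht
      rw [show t - ((i : ℤ) + 1) = t - i - 1 by ring, sub_add_cancel] at ht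
      exact ht
    have := (h.occ_suffix_append hs ht2.2).2
    rw [length_applyWord_replicate, List.length_replicate] at this
    exact ⟨this, ht2.1⟩
  obtain ⟨e1, z1⟩ := hs' ht
  rw [List.replicate_succ] at ht'
  obtain ⟨e2, z2⟩ := hs' ht'
  -- Behind the `i` common blocks `π 0`, one context reads `β :: s` and the other `α :: s`;
  -- agreement stops there.
  have o1 := (h.occ_split hs (t - i)).2 z1
  have o2 := (h.occ_split hs (t' - i)).1 z2
  by_contra hlt
  rw [not_le] at hlt
  have l1 : x (e (t - i) - (β :: s).length) = β := by
    rw [show β :: s = [β] ++ s from rfl, occ_append, occ_singleton] at o1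
    exact o1.1
  have l2 : x (e (t' - i) - (α :: s).length) = α := by
    rw [show α :: s = [α] ++ s from rfl, occ_append, occ_singleton] at o2
    exact o2.1
  have := fac_eq_apply hq (q - s.length - 1 - (i * (π 0).length : ℕ)) (by push_cast at *; omega)
    (by push_cast at *; omega)
  rw [e1, e2] at this
  simp only [List.length_cons] at l1 l2
  apply hne
  rw [← l1, ← l2]
  convert this.symm using 2 <;> push_cast <;> ring

end Context

end LowComplexity

namespace LowComplexity

variable {A : Type*}

/-! ### Growth of the number of factors -/

theorem numFac_add_le [Finite A] {x : ℤ → A} (h : ¬ RightPeriodic x) {Q₁ Q₂ : ℕ} (hQ : Q₁ ≤ Q₂) :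
    numFac x Q₁ + Q₂ ≤ numFac x Q₂ + Q₁ := by
  induction Q₂, hQ using Nat.le_induction with
  | base => exact le_rfl
  | succ q hq ih =>
    obtain ⟨w, hw⟩ := exists_rightSpecial h q
    have := numFac_add_card_le (x := x) (q := q) {w} (by simpa using hw)
    simp at this
    omega

/-- There are two different right-special words of length `q`. -/
def TwoRightSpecial (x : ℤ → A) (q : ℕ) : Prop :=
  ∃ w w', w ≠ w' ∧ w.length = q ∧ w'.length = q ∧ RightSpecial x w ∧ RightSpecial x w'

theorem TwoRightSpecial.numFac_add_two_le [Finite A] {x : ℤ → A} {q : ℕ}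
    (h : TwoRightSpecial x q) : numFac x q + 2 ≤ numFac x (q + 1) := by
  classical
  obtain ⟨w, w', hne, h1, h2, h3, h4⟩ := h
  have := numFac_add_card_le (x := x) (q := q) {w, w'} (by
    intro v hv
    rw [Finset.mem_insert, Finset.mem_singleton] at hv
    rcases hv with rfl | rfl
    · exact ⟨h1, h3⟩
    · exact ⟨h2, h4⟩)
  rwa [Finset.card_pair hne] at this

theorem numFac_add_two_mul_le [Finite A] {x : ℤ → A} {Q₁ Q₂ : ℕ} (hQ : Q₁ ≤ Q₂)
    (h : ∀ q, Q₁ ≤ q → q < Q₂ → TwoRightSpecial x q) :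
    numFac x Q₁ + 2 * Q₂ ≤ numFac x Q₂ + 2 * Q₁ := by
  induction Q₂, hQ using Nat.le_induction with
  | base => exact le_rfl
  | succ q hq ih =>
    have h1 := ih fun r hr hr' => h r hr (by omega)
    have h2 := (h q hq (by omega)).numFac_add_two_le
    omega

theorem numFac_zero (x : ℤ → A) : numFac x 0 = 1 := by
  have : facs x Set.univ 0 = {[]} := by
    ext w
    simp [facs]
  rw [numFac, this, Set.ncard_singleton]

/-! ### The desubstitution step -/

/-- The conjugate `0 ↦ 1 0 ^ (m - 1)`, `1 ↦ 0 ^ (n - m) 1 0 ^ (m - 1)` of `tau m n`. -/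
def sigma (m n : ℕ) (a : Fin 2) : List (Fin 2) :=
  if a = 0 then 1 :: List.replicate (m - 1) 0
  else List.replicate (n - m) 0 ++ 1 :: List.replicate (m - 1) 0

theorem sigma_ne_nil (m n : ℕ) (a : Fin 2) : sigma m n a ≠ [] := by
  unfold sigma
  split <;> simp

/-- A coding of `x` by two words, with good control on the right-special words of `x`. -/
structure Level (x : ℤ → A) (q₀ : ℕ) (π : Fin 2 → List A) (z : ℤ → Fin 2) (e : ℤ → ℤ)
    (s : List A) : Prop where
  coding : Coding x π z e
  ne_nil : π 0 ≠ []
  head_ne : (π 0).head? ≠ (π 1).head?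
  le : (π 0).length ≤ (π 1).length
  split : ∃ α β, α ≠ β ∧ SuffixSplit π s α β
  length_le : s.length + 2 ≤ (π 0).length + (π 1).length
  cut : ∀ w, RightSpecial x w → s.length ≤ w.length → ∀ i, Occ w x i → ∃ t, e t = i + w.length
  large : q₀ ≤ s.length

theorem Level.forall_ne_nil {x : ℤ → A} {q₀ : ℕ} {π : Fin 2 → List A} {z : ℤ → Fin 2} {e : ℤ → ℤ}
    {s : List A} (h : Level x q₀ π z e s) : ∀ b, π b ≠ [] := by
  have h0 := List.length_pos_iff.2 h.ne_nil
  have := h.le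
  exact forall_fin_two_ne_nil h.ne_nil (List.length_pos_iff.1 (by omega))

theorem Level.apply_ne {x : ℤ → A} {q₀ : ℕ} {π : Fin 2 → List A} {z : ℤ → Fin 2} {e : ℤ → ℤ}
    {s : List A} (h : Level x q₀ π z e s) {t t' : ℤ} (ht : z t = 0) (ht' : z t' = 1) :
    x (e t) ≠ x (e t') := by
  have h1 := h.coding.head?_eq h.forall_ne_nil t
  have h2 := h.coding.head?_eq h.forall_ne_nil t'
  rw [ht] at h1
  rw [ht'] at h2
  intro he
  exact h.head_ne (by rw [h1, h2, he])

/-- A code word followed by both letters yields right-special words of `x`: the two left contexts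
agree through `s ++ applyWord π c`, and the next blocks begin differently. -/
theorem Level.rightSpecial {x : ℤ → A} {q₀ : ℕ} {π : Fin 2 → List A} {z : ℤ → Fin 2} {e : ℤ → ℤ}
    {s : List A} (h : Level x q₀ π z e s) {t t' : ℤ} (ht : z t = 0) (ht' : z t' = 1)
    {c : List (Fin 2)} (hc : EndsAt z c t) (hc' : EndsAt z c t') {q : ℕ}
    (hq : q ≤ s.length + (applyWord π c).length) : RightSpecial x (fac x (e t - q) q) := by
  obtain ⟨α, β, -, hs⟩ := h.split
  have h1 := h.coding.fac_eq_of_endsAt hs hc hc' hq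
  refine ⟨e t - q, e t' - q, by simp, by simpa using h1.symm, ?_⟩
  simpa using h.apply_ne ht ht'

theorem endsAt_append {B : Type*} {z : ℤ → B} {u v : List B} {t : ℤ} :
    EndsAt z (u ++ v) t ↔ EndsAt z u (t - v.length) ∧ EndsAt z v t := by
  unfold EndsAt
  rw [show (fac z (t - (u ++ v).length) (u ++ v).length = u ++ v) =
    Occ (u ++ v) z (t - (u ++ v).length) from rfl, occ_append]
  unfold Occ
  rw [show t - ((u ++ v).length : ℤ) = t - v.length - u.length by simp; ring,
    show t - v.length - u.length + u.length = t - (v.length : ℤ) by ring]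

theorem endsAt_singleton {B : Type*} {z : ℤ → B} {b : B} {t : ℤ} :
    EndsAt z [b] t ↔ z (t - 1) = b := by
  simp [EndsAt, fac_one]

theorem endsAt_replicate {B : Type*} {z : ℤ → B} {b : B} {t : ℤ} {i : ℕ}
    (h : ∀ k, t - i ≤ k → k < t → z k = b) : EndsAt z (List.replicate i b) t := by
  unfold EndsAt
  simp only [List.length_replicate]
  apply List.ext_getElem
  · simp
  · intro k h1 h2
    rw [getElem_fac, List.getElem_replicate]
    simp only [length_fac] at h1
    exact h _ (by omega) (by omega)

/-- The positions `g j` of the letter `1` in `z`, with `r j` letters `0` between `g j` and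
`g (j + 1)`. -/
structure Runs (z : ℤ → Fin 2) (g : ℤ → ℤ) (r : ℤ → ℕ) : Prop where
  mono : StrictMono g
  next : ∀ j, g (j + 1) = g j + 1 + r j
  one : ∀ j, z (g j) = 1
  zero : ∀ j k, g j < k → k < g (j + 1) → z k = 0

namespace Runs

variable {z : ℤ → Fin 2} {g : ℤ → ℤ} {r : ℤ → ℕ}

theorem exists_of_unbounded (hr : ∀ N, ∃ i, N ≤ i ∧ z i = 1) (hl : ∀ N, ∃ i, i ≤ N ∧ z i = 1) :
    ∃ g r, Runs z g r := by
  obtain ⟨g, hg, h1, h2⟩ := exists_strictMono_range_eq hr hl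
  refine ⟨g, fun j => (g (j + 1) - g j - 1).toNat, hg, fun j => ?_, h1, fun j k hk hk' => ?_⟩
  · have := hg (show j < j + 1 by omega)
    omega
  · by_contra hc
    obtain ⟨i, rfl⟩ := h2 k (by omega)
    have a1 := hg.lt_iff_lt.1 hk
    have a2 := hg.lt_iff_lt.1 hk'
    omega

theorem endsAt_zeros (h : Runs z g r) {j t : ℤ} {i : ℕ} (h1 : g j + 1 + i ≤ t)
    (h2 : t ≤ g (j + 1)) : EndsAt z (List.replicate i 0) t :=
  endsAt_replicate fun k hk hk' => h.zero j k (by omega) (by omega)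

theorem endsAt_one_zeros (h : Runs z g r) {j : ℤ} {i : ℕ} (hi : i ≤ r j) :
    EndsAt z (1 :: List.replicate i 0) (g j + 1 + i) := by
  rw [show (1 : Fin 2) :: List.replicate i 0 = [1] ++ List.replicate i 0 from rfl, endsAt_append,
    endsAt_singleton]
  constructor
  · rw [← h.one j]
    congr 1
    simp
  · exact h.endsAt_zeros le_rfl (by rw [h.next]; omega)

theorem endsAt_zeros_one_zeros (h : Runs z g r) {j : ℤ} {i i' : ℕ} (hi : i ≤ r j)
    (hi' : i' ≤ r (j - 1)) :
    EndsAt z (List.replicate i' 0 ++ 1 :: List.replicate i 0) (g j + 1 + i) := by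
  rw [endsAt_append]
  refine ⟨?_, h.endsAt_one_zeros hi⟩
  have := h.next (j - 1)
  rw [sub_add_cancel] at this
  refine h.endsAt_zeros (j := j - 1) ?_ ?_
  · simp only [List.length_cons, List.length_replicate]; push_cast; omega
  · rw [sub_add_cancel]; simp only [List.length_cons, List.length_replicate]; push_cast; omega

theorem exists_index (h : Runs z g r) (t : ℤ) : ∃ j, ∃ i : ℕ, t = g j + 1 + i ∧ i ≤ r j := by
  obtain ⟨j, h1, h2⟩ := exists_block_of_strictMono h.mono (t - 1)
  have := h.next j
  exact ⟨j, (t - 1 - g j).toNat, by omega, by omega⟩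

/-- Cuts are placed `m` zeros after each `1`, the shortest run length. A block is then what remains
of the current run, the next `1` and `m` zeros. -/
theorem coding (h : Runs z g r) {m d : ℕ} (hr : ∀ j, r j = m ∨ r j = m + 1 + d) :
    Coding z (sigma (m + 1) (m + d + 2)) (fun j => if r j = m then 0 else 1)
      (fun j => g j + 1 + m) := by
  have hm : ∀ j, m ≤ r j := fun j => by rcases hr j with h | h <;> omega
  constructor
  · intro j
    have h1 := h.endsAt_zeros_one_zeros (j := j + 1) (i' := r j - m) (hm (j + 1))
      (by rw [add_sub_cancel_right]; omega)
    have h2 : sigma (m + 1) (m + d + 2) (if r j = m then 0 else 1) =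
        List.replicate (r j - m) 0 ++ 1 :: List.replicate m 0 := by
      rcases hr j with h' | h'
      · simp [sigma, h']
      · have : m + 1 + d ≠ m := by omega
        simp only [h', this, if_false, sigma]
        simp only [Fin.one_eq_zero_iff, OfNat.ofNat_ne_one, if_false]
        congr 2
        omega
    rw [h2]
    unfold EndsAt at h1
    unfold Occ
    convert h1 using 2
    rw [h.next]
    simp
    have := hm j
    omega
  · intro j
    rw [h.next]
    have := hm j
    rcases hr j with h' | h'
    · simp [sigma, h']; ring
    · have : m + 1 + d ≠ m := by omega
      simp [h', sigma, this]
      omega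

end Runs

theorem length_applyWord_sigma_zero (π : Fin 2 → List A) (j d : ℕ) :
    (applyWord π (sigma (j + 1) (j + d + 2) 0)).length = j * (π 0).length + (π 1).length := by
  simp [sigma]
  ring

theorem length_applyWord_sigma_one (π : Fin 2 → List A) (j d : ℕ) :
    (applyWord π (sigma (j + 1) (j + d + 2) 1)).length =
      (j + d + 1) * (π 0).length + (π 1).length := by
  have : j + d + 2 - (j + 1) = d + 1 := by omega
  simp [sigma, this]
  ring

/-- Every new block ends in `1 0 ^ j`. So behind the code word `0 ^ j 1 0 ^ j` stands a `1` if the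
last new block is that of `0`, and a `0` if it is that of `1`; hence `α` and `β` trade places. -/
theorem SuffixSplit.sigma {π : Fin 2 → List A} {s : List A} {α β : A} (h : SuffixSplit π s α β)
    (j d : ℕ) :
    SuffixSplit (fun a => applyWord π (sigma (j + 1) (j + d + 2) a))
      (s ++ applyWord π (List.replicate j 0 ++ 1 :: List.replicate j 0)) β α := by
  obtain ⟨N, hN⟩ := h
  refine ⟨N + 1, fun c hc => ?_⟩
  obtain ⟨c, b, rfl⟩ : ∃ c' b, c = c' ++ [b] := by
    rcases List.eq_nil_or_concat c with rfl | h
    · simp at hc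
    · simpa using h
  rw [List.length_append, List.length_singleton] at hc
  have hb : ∃ v, LowComplexity.sigma (j + 1) (j + d + 2) b = v ++ 1 :: List.replicate j 0 := by
    fin_cases b
    · exact ⟨[], rfl⟩
    · exact ⟨_, rfl⟩
  obtain ⟨v, hv⟩ := hb
  have hc2 := length_le_length_applyWord (sigma_ne_nil (j + 1) (j + d + 2)) c
  set u := applyWord (LowComplexity.sigma (j + 1) (j + d + 2)) c with hu
  have form : ∀ a, applyWord (fun a => applyWord π (LowComplexity.sigma (j + 1) (j + d + 2) a))
      (c ++ [b] ++ [a]) = applyWord π (u ++ v ++ 1 :: List.replicate j 0 ++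
        LowComplexity.sigma (j + 1) (j + d + 2) a) := by
    intro a
    rw [← applyWord_applyWord]
    congr 1
    simp [← hu, hv]
  constructor
  · rw [form]
    have h1 := (hN (u ++ v) (by rw [List.length_append]; omega)).2
    have : u ++ v ++ 1 :: List.replicate j 0 ++ LowComplexity.sigma (j + 1) (j + d + 2) 0 =
        (u ++ v ++ [1]) ++ (List.replicate j 0 ++ 1 :: List.replicate j 0) := by
      simp [LowComplexity.sigma]
    rw [this, applyWord_append π (u ++ v ++ [1]), ← List.cons_append]
    exact isSuffix_append_right h1 _
  · rw [form]
    have h1 := (hN (u ++ v ++ 1 :: List.replicate d 0)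
      (by rw [List.length_append, List.length_append]; omega)).1
    have : u ++ v ++ 1 :: List.replicate j 0 ++ LowComplexity.sigma (j + 1) (j + d + 2) 1 =
        (u ++ v ++ 1 :: List.replicate d 0 ++ [0]) ++
          (List.replicate j 0 ++ 1 :: List.replicate j 0) := by
      have h2 : j + d + 2 - (j + 1) = d + 1 := by omega
      have h3 : List.replicate j (0 : Fin 2) ++ List.replicate (d + 1) 0 =
          List.replicate d 0 ++ [0] ++ List.replicate j 0 := by
        rw [← List.replicate_succ', ← List.replicate_add, ← List.replicate_add, add_comm]
      have h4 : LowComplexity.sigma (j + 1) (j + d + 2) 1 =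
          List.replicate (d + 1) 0 ++ 1 :: List.replicate j 0 := by
        simp [LowComplexity.sigma, h2]
      rw [h4]
      have := congrArg (fun l => u ++ v ++ [1] ++ l ++ 1 :: List.replicate j 0) h3
      simpa only [List.append_assoc, List.cons_append, List.nil_append] using this
    rw [this, applyWord_append π (u ++ v ++ 1 :: List.replicate d 0 ++ [0]), ← List.cons_append]
    exact isSuffix_append_right h1 _

end LowComplexity

namespace LowComplexity

/-! ### Competing right-special words and the lengths of runs -/

variable {A : Type*} {x : ℤ → A} {q₀ : ℕ} {π : Fin 2 → List A} {z : ℤ → Fin 2} {e : ℤ → ℤ}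
  {s : List A} {g : ℤ → ℤ} {r : ℤ → ℕ}

theorem Level.exists_runs (h : Level x q₀ π z e s) (hR : ¬ RightPeriodic x)
    (hL : ¬ LeftPeriodic x) : ∃ g r, Runs z g r := by
  apply Runs.exists_of_unbounded
  · intro N
    by_contra hc
    push Not at hc
    exact hR (h.coding.rightPeriodic h.forall_ne_nil (b := 0) (T := N) fun t ht => by
      have := hc t ht
      omega)
  · intro N
    by_contra hc
    push Not at hc
    exact hL (h.coding.leftPeriodic h.forall_ne_nil (b := 0) (T := N) fun t ht => by
      have := hc t ht
      omega)

/-- Cuts preceded by runs of `π 0` of different lengths have a short common left context. -/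
theorem Level.length_le_of_runs (h : Level x q₀ π z e s) (hr : Runs z g r) {j j' : ℤ} {i i' : ℕ}
    (hi : i ≤ r j) (hi' : i' ≤ r j') (hii : i < i') {q : ℕ}
    (hq : fac x (e (g j + 1 + i) - q) q = fac x (e (g j' + 1 + i') - q) q) :
    q ≤ s.length + i * (π 0).length := by
  obtain ⟨α, β, hne, hs⟩ := h.split
  refine h.coding.length_le_of_fac_eq hs hne (hr.endsAt_one_zeros hi)
    (hr.endsAt_zeros (j := j') ?_ ?_) hq
  · push_cast; omega
  · rw [hr.next]; omega

section Bounds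

variable {j₀ J J₂ : ℤ}

/-- The code word `0 ^ r 1 0 ^ r`, with `r` the shortest run length, is followed by `0` inside a
longer run and by `1` after a shortest one. -/
theorem Level.rightSpecial_one (h : Level x q₀ π z e s) (hr : Runs z g r)
    (hmin : ∀ j, r j₀ ≤ r j) (hJ : r j₀ < r J) {q : ℕ}
    (hq : q ≤ s.length + (2 * r j₀ * (π 0).length + (π 1).length)) :
    RightSpecial x (fac x (e (g J + 1 + r j₀) - q) q) := by
  refine h.rightSpecial (t' := g j₀ + 1 + r j₀) (c := List.replicate (r j₀) 0 ++ 1 :: List.replicate (r j₀) 0)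
    ?_ ?_ (hr.endsAt_zeros_one_zeros hJ.le (hmin _)) (hr.endsAt_zeros_one_zeros le_rfl (hmin _)) ?_
  · exact hr.zero J _ (by omega) (by rw [hr.next]; omega)
  · rw [← hr.next]; exact hr.one _
  · simp only [applyWord_append, applyWord_cons, List.length_append, length_applyWord_replicate]
    linarith

/-- In a run longer than `k`, the word `0 ^ k` is followed by `0` at the start of the run and by `1`
at its end. -/
theorem Level.rightSpecial_zero (h : Level x q₀ π z e s) (hr : Runs z g r) {k : ℕ}
    (hJ : k + 1 ≤ r J) {q : ℕ} (hq : q ≤ s.length + k * (π 0).length) :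
    RightSpecial x (fac x (e (g J + 1 + k) - q) q) := by
  refine h.rightSpecial (t' := g (J + 1)) (c := List.replicate k 0) ?_ (hr.one _)
    (hr.endsAt_zeros (j := J) le_rfl ?_) (hr.endsAt_zeros (j := J) ?_ le_rfl) (by simpa using hq)
  · exact hr.zero J _ (by omega) (by rw [hr.next]; omega)
  · rw [hr.next]; omega
  · rw [hr.next]; omega

/-- The competitor produced by an intermediate run length, used to exclude a third length. -/
theorem Level.rightSpecial_two (h : Level x q₀ π z e s) (hr : Runs z g r)
    (hmin : ∀ j, r j₀ ≤ r j) (hJ : r J₂ < r J) {q : ℕ}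
    (hq : q ≤ s.length + ((r j₀ + r J₂) * (π 0).length + (π 1).length)) :
    RightSpecial x (fac x (e (g J + 1 + r J₂) - q) q) := by
  refine h.rightSpecial (t' := g J₂ + 1 + r J₂) (c := List.replicate (r j₀) 0 ++ 1 :: List.replicate (r J₂) 0)
    ?_ ?_ (hr.endsAt_zeros_one_zeros hJ.le (hmin _)) (hr.endsAt_zeros_one_zeros le_rfl (hmin _)) ?_
  · exact hr.zero J _ (by omega) (by rw [hr.next]; omega)
  · rw [← hr.next]; exact hr.one _
  · simp only [applyWord_append, applyWord_cons, List.length_append, length_applyWord_replicate]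
    linarith

theorem Level.twoRightSpecial_of_le (h : Level x q₀ π z e s) (hr : Runs z g r)
    (hmin : ∀ j, r j₀ ≤ r j) {d : ℕ} (hJ : r J = r j₀ + 1 + d) {q : ℕ}
    (hq₁ : s.length + r j₀ * (π 0).length < q)
    (hq₂ : q ≤ s.length + (2 * r j₀ * (π 0).length + (π 1).length))
    (hq₃ : q ≤ s.length + (r j₀ + d) * (π 0).length) : TwoRightSpecial x q := by
  refine ⟨_, _, ?_, length_fac _ _ _, length_fac _ _ _,
    h.rightSpecial_one hr hmin (J := J) (by omega) hq₂,
    h.rightSpecial_zero hr (J := J) (k := r j₀ + d) (by omega) hq₃⟩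
  intro he
  rcases Nat.eq_zero_or_pos d with rfl | hd
  · simp at hq₃
    omega
  · have := h.length_le_of_runs hr (j := J) (j' := J) (i := r j₀) (i' := r j₀ + d) (by omega)
      (by omega) (by omega) he
    omega

theorem Level.twoRightSpecial_of_three (h : Level x q₀ π z e s) (hr : Runs z g r)
    (hmin : ∀ j, r j₀ ≤ r j) (hJ₂ : r j₀ < r J₂) (hJ : r J₂ < r J) {q : ℕ}
    (hq₁ : s.length + r j₀ * (π 0).length < q)
    (hq₂ : q ≤ s.length + (2 * r j₀ * (π 0).length + (π 1).length)) : TwoRightSpecial x q := by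
  refine ⟨_, _, ?_, length_fac _ _ _, length_fac _ _ _,
    h.rightSpecial_one hr hmin (J := J) (by omega) hq₂,
    h.rightSpecial_two hr hmin (J₂ := J₂) (J := J) hJ (hq₂.trans ?_)⟩
  · intro he
    have := h.length_le_of_runs hr (j := J) (j' := J) (i := r j₀) (i' := r J₂) (by omega)
      (by omega) (by omega) he
    omega
  · have : 2 * r j₀ * (π 0).length ≤ (r j₀ + r J₂) * (π 0).length :=
      Nat.mul_le_mul_right _ (by omega)
    omega

/-- There is not always a second right-special word in the range of lengths where the first
exceptional right-special word exists. -/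
theorem Level.false_of_twoRightSpecial [Finite A] (h : Level x q₀ π z e s) (hR : ¬ RightPeriodic x)
    (hb : ∀ q, q₀ ≤ q → 3 * numFac x q < 4 * q) {j : ℕ}
    (hq : ∀ q, s.length + j * (π 0).length < q →
      q ≤ s.length + (2 * j * (π 0).length + (π 1).length) → TwoRightSpecial x q) : False := by
  set a := (π 0).length
  set b := (π 1).length
  have hab : a ≤ b := h.le
  have hs : s.length + 2 ≤ a + b := h.length_le
  have hl : q₀ ≤ s.length := h.large
  have e2 : 2 * j * a = j * a + j * a := by ring
  -- Growth by two over `j * a + b` consecutive lengths gives at least `|s| + 3 * j * a + 2 * b + 2`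
  -- factors of length `|s| + 2 * j * a + b + 1`. Since `|s| + 2 ≤ a + b ≤ 2 * b`, this violates the
  -- bound.
  have h1 := numFac_add_two_mul_le (x := x) (Q₁ := s.length + j * a + 1)
    (Q₂ := s.length + (2 * j * a + b) + 1) (by omega)
    (fun q h1 h2 => hq q (by omega) (by omega))
  have h2 := numFac_add_le hR (Nat.zero_le (s.length + j * a + 1))
  rw [numFac_zero] at h2
  have h3 := hb (s.length + (2 * j * a + b) + 1) (by omega)
  omega

end Bounds

/-- The run lengths take exactly two values. -/
theorem Level.exists_two_runs [Finite A] (h : Level x q₀ π z e s) (hr : Runs z g r)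
    (hR : ¬ RightPeriodic x) (hb : ∀ q, q₀ ≤ q → 3 * numFac x q < 4 * q) :
    ∃ j d : ℕ, (∀ i, r i = j ∨ r i = j + 1 + d) ∧ (∃ i, r i = j) ∧ (∃ i, r i = j + 1 + d) ∧
      (j + d) * (π 0).length < 2 * j * (π 0).length + (π 1).length := by
  obtain ⟨j₀, hmin⟩ : ∃ j₀, ∀ j, r j₀ ≤ r j := 
    ⟨Function.argmin r, fun j => Function.argmin_le r j⟩
  obtain ⟨J, hJ⟩ : ∃ J, r j₀ < r J := by
    by_contra hc
    push Not at hc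
    -- With a single run length the code is eventually constant after one desubstitution, making `x`
    -- periodic; `d := 0` below is a dummy.
    have heq : ∀ j, r j = r j₀ := fun j => le_antisymm (hc j) (hmin j)
    have hcod := h.coding.comp (hr.coding (m := r j₀) (d := 0) fun j => Or.inl (heq j))
    have hne : ∀ b, applyWord π (sigma (r j₀ + 1) (r j₀ + 0 + 2) b) ≠ [] := by
      intro b hb
      have h1 := length_le_length_applyWord h.forall_ne_nil (sigma (r j₀ + 1) (r j₀ + 0 + 2) b)
      rw [hb] at h1
      exact sigma_ne_nil _ _ b (List.length_eq_zero_iff.1 (by simpa using h1))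
    exact hR (hcod.rightPeriodic hne (b := 0) (T := 0) fun t _ => by simp [heq])
  refine ⟨r j₀, r J - r j₀ - 1, ?_, ⟨j₀, rfl⟩, ⟨J, by omega⟩, ?_⟩
  · intro i
    by_contra hc
    push Not at hc
    have := hmin i
    rcases lt_or_gt_of_ne hc.2 with hlt | hlt
    · exact h.false_of_twoRightSpecial hR hb fun q h1 h2 =>
        h.twoRightSpecial_of_three hr hmin (J₂ := i) (J := J) (by omega) (by omega) h1 h2
    · exact h.false_of_twoRightSpecial hR hb fun q h1 h2 =>
        h.twoRightSpecial_of_three hr hmin (J₂ := J) (J := i) (by omega) (by omega) h1 h2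
  -- Otherwise the powers of `π 0` remain right-special over the whole forbidden range.
  · by_contra hc
    exact h.false_of_twoRightSpecial hR hb fun q h1 h2 =>
      h.twoRightSpecial_of_le hr hmin (J := J) (d := r J - r j₀ - 1) (by omega) h1 h2 (by omega)

/-- Every sufficiently long right-special word ends at a cut preceded by `π 1` and a shortest run
of `π 0`. -/
theorem Level.exists_cut (h : Level x q₀ π z e s) (hr : Runs z g r) {j d : ℕ}
    (hrun : ∀ i, r i = j ∨ r i = j + 1 + d)
    (hjd : (j + d) * (π 0).length < 2 * j * (π 0).length + (π 1).length) {w : List A}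
    (hw : RightSpecial x w)
    (hlen : s.length + (2 * j * (π 0).length + (π 1).length) ≤ w.length) {i : ℤ} (hi : Occ w x i) :
    ∃ t, e (g t + 1 + j) = i + w.length := by
  have hj : j * (π 0).length < 2 * j * (π 0).length + (π 1).length := by
    have h1 := h.le
    have h2 := List.length_pos_iff.2 h.ne_nil
    have : 2 * j * (π 0).length = j * (π 0).length + j * (π 0).length := by ring
    omega
  have hend : ∀ i, Occ w x i → ∃ k, ∃ l : ℕ, e (g k + 1 + l) = i + w.length ∧ l ≤ r k := by
    intro i hi
    obtain ⟨t, ht⟩ := h.cut w hw (by omega) i hi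
    obtain ⟨k, l, rfl, hl⟩ := hr.exists_index t
    exact ⟨k, l, ht, hl⟩
  have hcmp : ∀ {i i' k k' : ℤ} {l l' : ℕ}, Occ w x i → Occ w x i' →
      e (g k + 1 + l) = i + w.length → e (g k' + 1 + l') = i' + w.length → l ≤ r k → l' ≤ r k' →
      l < l' → w.length ≤ s.length + l * (π 0).length := by
    intro i i' k k' l l' hi hi' he he' hl hl' hll
    refine h.length_le_of_runs hr hl hl' hll ?_
    rw [he, he', add_sub_cancel_right, add_sub_cancel_right]
    exact hi.fac_eq hi'
  -- two occurrences with different continuations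
  have main : ∃ i k, Occ w x i ∧ e (g k + 1 + j) = i + w.length := by
    obtain ⟨i₁, i₂, h1, h2, hne⟩ := hw
    obtain ⟨k₁, l₁, e1, hl1⟩ := hend i₁ h1
    obtain ⟨k₂, l₂, e2, hl2⟩ := hend i₂ h2
    have hz : z (g k₁ + 1 + l₁) ≠ z (g k₂ + 1 + l₂) := by
      intro hz
      apply hne
      have o1 := h.coding.head?_eq h.forall_ne_nil (g k₁ + 1 + l₁)
      have o2 := h.coding.head?_eq h.forall_ne_nil (g k₂ + 1 + l₂)
      rw [hz, o2] at o1
      rw [← e1, ← e2]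
      exact (Option.some.inj o1).symm
    have hzr : ∀ {k : ℤ} {l : ℕ}, l = r k → z (g k + 1 + l) = 1 := by
      intro k l hl
      rw [hl, ← hr.next]
      exact hr.one _
    have hzr' : ∀ {k : ℤ} {l : ℕ}, l < r k → z (g k + 1 + l) = 0 := by
      intro k l hl
      exact hr.zero k _ (by omega) (by rw [hr.next]; omega)
    -- a cut followed by `π 0` and a cut followed by `π 1`
    have case : ∀ {i i' k k' : ℤ} {l l' : ℕ}, Occ w x i → Occ w x i' →
        e (g k + 1 + l) = i + w.length → e (g k' + 1 + l') = i' + w.length → l < r k → l' = r k' →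
        ∃ i k, Occ w x i ∧ e (g k + 1 + j) = i + w.length := by
      intro i i' k k' l l' hi hi' he he' hl hl'
      -- A cut followed by `π 0` has at most `j + d` zeros behind it. As `w` is too long for
      -- differing counts, the cut followed by `π 1` has the same count, which is a full run length
      -- and hence `j`.
      have hlb : ∀ p : ℕ, p ≤ j + d → w.length ≤ s.length + p * (π 0).length → False := by
        intro p hp hwp
        have : p * (π 0).length ≤ (j + d) * (π 0).length := Nat.mul_le_mul_right _ hp
        omega
      have hljd : l ≤ j + d := by rcases hrun k with h' | h' <;> omega
      rcases lt_trichotomy l l' with hll | hll | hll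
      · exact (hlb l hljd (hcmp hi hi' he he' hl.le hl'.le hll)).elim
      · refine ⟨i', k', hi', ?_⟩
        rw [← he']
        congr 2
        rcases hrun k' with h' | h' <;> omega
      · exact (hlb l' (by omega) (hcmp hi' hi he' he hl'.le hl.le hll)).elim
    rcases hl1.lt_or_eq with c1 | c1 <;> rcases hl2.lt_or_eq with c2 | c2
    · exact absurd ((hzr' c1).trans (hzr' c2).symm) hz
    · exact case h1 h2 e1 e2 c1 c2
    · exact case h2 h1 e2 e1 c2 c1
    · exact absurd ((hzr c1).trans (hzr c2).symm) hz
  obtain ⟨i', k', hi', he'⟩ := main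
  obtain ⟨k, l, he, hl⟩ := hend i hi
  have hj' : j ≤ r k' := by rcases hrun k' with h' | h' <;> omega
  rcases lt_trichotomy l j with hlj | rfl | hlj
  · have h1 := hcmp hi hi' he he' hl hj' hlj
    have : l * (π 0).length ≤ j * (π 0).length := Nat.mul_le_mul_right _ hlj.le
    omega
  · exact ⟨k, he⟩
  · have h1 := hcmp hi' hi he' he hj' hl hlj
    omega

/-- The desubstitution step, with the constraints on the number of factors. -/
theorem Level.step [Finite A] (h : Level x q₀ π z e s) (hR : ¬ RightPeriodic x)
    (hL : ¬ LeftPeriodic x) (hb : ∀ q, q₀ ≤ q → 3 * numFac x q < 4 * q) :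
    ∃ (j d : ℕ) (z' : ℤ → Fin 2) (g : ℤ → ℤ) (s' : List A),
      Coding z (sigma (j + 1) (j + d + 2)) z' g ∧
      (∃ i, z' i = 0) ∧ (∃ i, z' i = 1) ∧
      Level x q₀ (fun a => applyWord π (sigma (j + 1) (j + d + 2) a)) z' (e ∘ g) s' ∧
      numFac x (s.length + 1) + s'.length + d * (π 0).length ≤
        numFac x (s'.length + 1) + s.length ∧
      3 * (numFac x (s.length + 1) + d * (π 0).length) ≤
        4 * s.length + (j + d) * (π 0).length + 3 := by
  obtain ⟨g, r, hr⟩ := h.exists_runs hR hL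
  obtain ⟨j, d, hrun, ⟨i₀, hi₀⟩, ⟨i₁, hi₁⟩, hjd⟩ := h.exists_two_runs hr hR hb
  have hmin : ∀ i, r i₀ ≤ r i := by
    intro i
    rcases hrun i with h' | h' <;> omega
  have hcod := hr.coding hrun
  obtain ⟨α, β, hne, hs⟩ := h.split
  have hlen : (s ++ applyWord π (List.replicate j 0 ++ 1 :: List.replicate j 0)).length =
      s.length + (2 * j * (π 0).length + (π 1).length) := by
    simp only [applyWord_append, applyWord_cons, List.length_append, length_applyWord_replicate]
    ring
  have hpos := List.length_pos_iff.2 h.ne_nil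
  have hle := h.le
  have hsl := h.length_le
  have e2 : 2 * j * (π 0).length = j * (π 0).length + j * (π 0).length := by ring
  have e3 : (j + d) * (π 0).length = j * (π 0).length + d * (π 0).length := by ring
  have e4 : (j + d + 1) * (π 0).length =
    j * (π 0).length + d * (π 0).length + (π 0).length := by ring
  -- Two right-special words coexist on `d * a` consecutive lengths. This is the source of the
  -- excess, and the complexity bound at the end of the range limits it.
  have hQ := numFac_add_two_mul_le (x := x) (Q₁ := s.length + j * (π 0).length + 1)
    (Q₂ := s.length + (j + d) * (π 0).length + 1) (by omega) (fun q h1 h2 =>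
      h.twoRightSpecial_of_le hr hmin (J := i₁) (d := d) (by omega) (by rw [hi₀]; omega)
        (by rw [hi₀]; omega) (by rw [hi₀]; omega))
  have hQ' := numFac_add_le hR
    (show s.length + 1 ≤ s.length + j * (π 0).length + 1 by omega)
  have hlarge := h.large
  have hb' := hb (s.length + (j + d) * (π 0).length + 1) (by omega)
  refine ⟨j, d, _, _, s ++ applyWord π (List.replicate j 0 ++ 1 :: List.replicate j 0), hcod,
    ⟨i₀, by simp [hi₀]⟩, ⟨i₁, by simp [hi₁]; omega⟩, ?_, ?_, ?_⟩
  · constructor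
    · exact h.coding.comp hcod
    · intro h0
      have := congrArg List.length h0
      rw [length_applyWord_sigma_zero] at this
      simp only [List.length_nil] at this
      omega
    -- The image of `0` under `sigma` begins with `1` and that of `1` with `0`, so the first letters
    -- are exchanged.
    · have c0 := h.coding.head?_eq h.forall_ne_nil
      simp only [sigma, if_true, Fin.one_eq_zero_iff, OfNat.ofNat_ne_one, if_false,
        show j + d + 2 - (j + 1) = d + 1 by omega, List.replicate_succ, List.cons_append,
        applyWord_cons]
      intro he
      apply h.head_ne
      rw [List.head?_append, List.head?_append] at he
      cases h0 : π 0 with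
      | nil => exact absurd h0 h.ne_nil
      | cons a u =>
        cases h1 : π 1 with
        | nil => exact absurd h1 (h.forall_ne_nil 1)
        | cons b v =>
          rw [h0, h1] at he
          simpa using he.symm
    · rw [length_applyWord_sigma_zero, length_applyWord_sigma_one]
      omega
    · exact ⟨β, α, hne.symm, hs.sigma j d⟩
    · rw [length_applyWord_sigma_zero, length_applyWord_sigma_one, hlen]
      omega
    · intro w hw hwl i hi
      rw [hlen] at hwl
      exact h.exists_cut hr hrun hjd hw hwl hi
    · rw [hlen]; omega
  · rw [hlen]
    have := numFac_add_le hR (show s.length + (j + d) * (π 0).length + 1 ≤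
      s.length + (2 * j * (π 0).length + (π 1).length) + 1 by omega)
    omega
  · omega

end LowComplexity

namespace LowComplexity

variable {A : Type*} {x : ℤ → A} {q₀ : ℕ}

/-! ### Return words to a right-special word -/

/-- Growth by two at every length from `q₀` on would exceed slope `4/3`. -/
theorem exists_numFac_succ_le (hb : ∀ q, q₀ ≤ q → 3 * numFac x q < 4 * q) :
    ∃ q, q₀ ≤ q ∧ numFac x (q + 1) ≤ numFac x q + 1 := by
  by_contra hc
  push Not at hc
  have key : ∀ k : ℕ, numFac x q₀ + 2 * k ≤ numFac x (q₀ + k) := by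
    intro k
    induction k with
    | zero => simp
    | succ k ih =>
      have := hc (q₀ + k) (by omega)
      rw [← add_assoc]
      omega
  have h1 := key (2 * q₀ + 1)
  have h2 := hb (q₀ + (2 * q₀ + 1)) (by omega)
  omega

/-- Growth by at most one leaves a single exceptional word of length `q + 1`: only its prefix is
right-special, with the chosen and the exceptional letter as its only continuations. -/
theorem exists_unique_rightSpecial [Finite A] (hR : ¬ RightPeriodic x) {q : ℕ}
    (hq : numFac x (q + 1) ≤ numFac x q + 1) :
    ∃ (w : List A) (α β : A) (i j : ℤ), α ≠ β ∧ fac x i q = w ∧ fac x j q = w ∧ x (i + q) = α ∧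
      x (j + q) = β ∧ (∀ k, fac x k q = w → x (k + q) = α ∨ x (k + q) = β) ∧
      ∀ k l, fac x k q = fac x l q → x (k + q) ≠ x (l + q) → fac x k q = w := by
  obtain ⟨f, hf⟩ := exists_unique_exception hq
  have hf' : ∀ k l, x (k + q) ≠ x (f (fac x k q) + q) → x (l + q) ≠ x (f (fac x l q) + q) →
      fac x k q = fac x l q ∧ x (k + q) = x (l + q) := by
    intro k l hk hl
    have := hf k l hk hl
    exact ⟨by simpa using fac_eq_sub this 0 le_rfl q (by push_cast; omega),
      fac_eq_apply this q (by omega) (by push_cast; omega)⟩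
  obtain ⟨w, rfl, i, j, hi, hj, hne⟩ := exists_rightSpecial hR q
  have main : ∀ i j, fac x i w.length = w → fac x j w.length = w →
      x (i + w.length) = x (f w + w.length) → x (j + w.length) ≠ x (f w + w.length) →
      ∃ (w' : List A) (α β : A) (i j : ℤ), α ≠ β ∧ fac x i w.length = w' ∧ fac x j w.length = w' ∧
      x (i + w.length) = α ∧ x (j + w.length) = β ∧
      (∀ k, fac x k w.length = w' → x (k + w.length) = α ∨ x (k + w.length) = β) ∧
      ∀ k l, fac x k w.length = fac x l w.length → x (k + w.length) ≠ x (l + w.length) →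
        fac x k w.length = w' := by
    intro i j hi hj hli hlj
    refine ⟨w, _, _, i, j, ?_, hi, hj, rfl, rfl, ?_, ?_⟩
    · rw [hli]; exact hlj.symm
    · intro k hk
      by_cases hc : x (k + w.length) = x (f w + w.length)
      · left; rw [hc, hli]
      · right; exact (hf' k j (by rwa [hk]) (by rwa [hj])).2
    · intro k l hkl hne
      by_cases hc : x (k + w.length) = x (f (fac x k w.length) + w.length)
      · refine (hkl.trans (hf' l j ?_ (by rwa [hj])).1).trans hj
        rw [← hkl, ← hc]
        exact hne.symm
      · exact (hf' k j hc (by rwa [hj])).1.trans hj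
  by_cases hli : x (i + w.length) = x (f w + w.length)
  · exact main i j hi hj hli fun hc => hne (hli.trans hc.symm)
  · by_cases hlj : x (j + w.length) = x (f w + w.length)
    · exact main j i hj hi hlj hli
    · exact absurd (hf' i j (by rwa [hi]) (by rwa [hj])).2 hne

/-- The occurrences `g j` of the only right-special word `w` of length `q`. -/
structure Returns (x : ℤ → A) (q : ℕ) (w : List A) (g : ℤ → ℤ) : Prop where
  mono : StrictMono g
  occ : ∀ j, fac x (g j) q = w
  surj : ∀ i, fac x i q = w → ∃ j, g j = i
  det : ∀ k l, fac x k q = fac x l q → x (k + q) ≠ x (l + q) → fac x k q = w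

namespace Returns

variable {q : ℕ} {w : List A} {g : ℤ → ℤ}

/-- Only `w` offers a choice of continuation, so the first letter after `w` determines everything up
to the next `w`. -/
theorem fac_eq (h : Returns x q w g) {j j' : ℤ} (he : x (g j + q) = x (g j' + q)) (k : ℕ)
    (hk : g j + k < g (j + 1)) :
    fac x (g j) (q + k + 1) = fac x (g j') (q + k + 1) := by
  induction k with
  | zero => rw [add_zero, fac_succ, fac_succ, h.occ, h.occ, he]
  | succ k ih =>
    have h1 := ih (by push_cast at hk; omega)
    have h2 := fac_eq_sub h1 (k + 1) (by omega) q (by push_cast; omega)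
    have h3 : x (g j + (k + 1) + q) = x (g j' + (k + 1) + q) := by
      by_contra hne
      obtain ⟨i, hi⟩ := h.surj _ (h.det _ _ h2 hne)
      have a1 := h.mono.lt_iff_lt.1 (show g j < g i by omega)
      have a2 := h.mono.lt_iff_lt.1 (show g i < g (j + 1) by push_cast at hk; omega)
      omega
    rw [show q + (k + 1) + 1 = q + k + 1 + 1 by ring, fac_succ, h1, fac_succ x (g j') (q + k + 1),
      show g j + ((q + k + 1 : ℕ) : ℤ) = g j + (k + 1) + q by push_cast; ring, h3,
      show g j' + ((q + k + 1 : ℕ) : ℤ) = g j' + (k + 1) + q by push_cast; ring]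

theorem next_sub_le (h : Returns x q w g) {j j' : ℤ} (he : x (g j + q) = x (g j' + q)) :
    g (j' + 1) - g j' ≤ g (j + 1) - g j := by
  have hlt : g j < g (j + 1) := h.mono (by omega)
  have h1 := h.fac_eq he (g (j + 1) - g j - 1).toNat (by omega)
  have h2 := fac_eq_sub h1 (g (j + 1) - g j) (by omega) q (by push_cast; omega)
  rw [add_sub_cancel, h.occ] at h2
  obtain ⟨i, hi⟩ := h.surj _ h2.symm
  have a1 := h.mono.lt_iff_lt.1 (show g j' < g i by omega)
  have := h.mono.monotone (show j' + 1 ≤ i by omega)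
  omega

theorem return_eq (h : Returns x q w g) {j j' : ℤ} (he : x (g j + q) = x (g j' + q)) :
    g (j' + 1) - g j' = g (j + 1) - g j ∧ fac x (g j + q) (g (j + 1) - g j).toNat =
      fac x (g j' + q) (g (j + 1) - g j).toNat := by
  refine ⟨le_antisymm (h.next_sub_le he) (h.next_sub_le he.symm), ?_⟩
  have hlt : g j < g (j + 1) := h.mono (by omega)
  have h1 := h.fac_eq he (g (j + 1) - g j - 1).toNat (by omega)
  exact fac_eq_sub h1 q (by omega) _ (by push_cast; omega)

theorem exists_level (h : Returns x q w g) (hq : q₀ ≤ q) {α β : A} (hne : α ≠ β) {jα jβ : ℤ}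
    (hα : x (g jα + q) = α) (hβ : x (g jβ + q) = β)
    (hdich : ∀ j, x (g j + q) = α ∨ x (g j + q) = β)
    (hle : g (jα + 1) - g jα ≤ g (jβ + 1) - g jβ) : ∃ π z e s, Level x q₀ π z e s := by
  classical
  have hlt : ∀ j, g j < g (j + 1) := fun j => h.mono (by omega)
  obtain ⟨lα, hlα⟩ : ∃ l : ℕ, (g (jα + 1) - g jα).toNat = l + 1 :=
    ⟨(g (jα + 1) - g jα).toNat - 1, by have := hlt jα; omega⟩
  obtain ⟨lβ, hlβ⟩ : ∃ l : ℕ, (g (jβ + 1) - g jβ).toNat = l + 1 :=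
    ⟨(g (jβ + 1) - g jβ).toNat - 1, by have := hlt jβ; omega⟩
  let π : Fin 2 → List A := ![fac x (g jα + q) (lα + 1), fac x (g jβ + q) (lβ + 1)]
  let z : ℤ → Fin 2 := fun j => if x (g j + q) = α then 0 else 1
  have p0 : π 0 = fac x (g jα + q) (lα + 1) := rfl
  have p1 : π 1 = fac x (g jβ + q) (lβ + 1) := rfl
  have hcod : Coding x π z (fun j => g j + q) := by
    have key : ∀ j, fac x (g j + q) (π (z j)).length = π (z j) ∧
        g (j + 1) = g j + (π (z j)).length := by
      intro j
      have := hlt j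
      by_cases hj : x (g j + q) = α
      · have hz : z j = 0 := by simp [z, hj]
        obtain ⟨a1, a2⟩ := h.return_eq (hα.trans hj.symm)
        rw [hz, p0, length_fac]
        rw [hlα] at a2
        exact ⟨a2.symm, by omega⟩
      · have hz : z j = 1 := by simp [z, hj]
        obtain ⟨a1, a2⟩ := h.return_eq (hβ.trans ((hdich j).resolve_left hj).symm)
        rw [hz, p1, length_fac]
        rw [hlβ] at a2
        exact ⟨a2.symm, by omega⟩
    refine ⟨fun j => (key j).1, fun j => ?_⟩
    rw [(key j).2]
    ring
  have hh : (π 0).head? ≠ (π 1).head? := by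
    rw [p0, p1, fac_succ_left, fac_succ_left, hα, hβ]
    simpa using hne
  have n0 : π 0 ≠ [] := by rw [p0, fac_succ_left]; simp
  have n1 : π 1 ≠ [] := by rw [p1, fac_succ_left]; simp
  have hle' : (π 0).length ≤ (π 1).length := by
    rw [p0, p1, length_fac, length_fac]
    omega
  obtain ⟨s, a, b, hab, hs, hsl⟩ := exists_suffixSplit n0 n1 hh hle'
  -- Cuts after either block are preceded by `w`, so `w` lies in the maximal common suffix.
  have hqs : q ≤ s.length := by
    have := hcod.length_le_of_fac_eq hs hab (i := 0) (t := jβ + 1) (t' := jα + 1) (q := q)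
      (by simp [endsAt_singleton, z, hβ, hne.symm]) (by simp [endsAt_singleton, z, hα])
      (by rw [add_sub_cancel_right, add_sub_cancel_right, h.occ, h.occ])
    simpa using this
  refine ⟨π, z, _, s, hcod, n0, hh, hle', ⟨a, b, hab, hs⟩, hsl, ?_, hq.trans hqs⟩
  -- The suffix of length `q` of a right-special word is right-special, hence `w`, and the cuts are
  -- the ends of the occurrences of `w`.
  rintro v ⟨i₁, i₂, h1, h2, hv⟩ hlen i hi
  have e1 := fac_eq_sub (h1.trans h2.symm) (v.length - q) (by omega) q (by omega)
  have e2 := fac_eq_sub (h1.trans (Eq.symm hi)) (v.length - q) (by omega) q (by omega)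
  have e3 := h.det _ _ e1 (by
    rw [show i₁ + ((v.length : ℤ) - q) + q = i₁ + v.length by ring,
      show i₂ + ((v.length : ℤ) - q) + q = i₂ + v.length by ring]
    exact hv)
  obtain ⟨t, ht⟩ := h.surj _ (e2.symm.trans e3)
  exact ⟨t, by simp only [ht]; ring⟩

end Returns

theorem exists_level [Finite A] (hrec : BiRecurrent x) (hR : ¬ RightPeriodic x)
    (hb : ∀ q, q₀ ≤ q → 3 * numFac x q < 4 * q) : ∃ π z e s, Level x q₀ π z e s := by
  obtain ⟨q, hq, hn⟩ := exists_numFac_succ_le hb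
  obtain ⟨w, α, β, i, j, hne, hi, hj, hα, hβ, hdich, hdet⟩ := exists_unique_rightSpecial hR hn
  obtain ⟨g, hg, h1, h2⟩ := exists_strictMono_range_eq (P := fun k => fac x k q = w)
    (fun N => by
      obtain ⟨k, hk, he⟩ := (hrec i q N).1
      exact ⟨k, hk, he.trans hi⟩)
    (fun N => by
      obtain ⟨k, hk, he⟩ := (hrec i q N).2
      exact ⟨k, hk, he.trans hi⟩)
  have hret : Returns x q w g := ⟨hg, h1, h2, hdet⟩
  obtain ⟨jα, rfl⟩ := h2 i hi
  obtain ⟨jβ, rfl⟩ := h2 j hj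
  rcases le_total (g (jα + 1) - g jα) (g (jβ + 1) - g jβ) with hle | hle
  · exact hret.exists_level hq hne hα hβ (fun k => hdich _ (h1 k)) hle
  · exact hret.exists_level hq hne.symm hβ hα (fun k => (hdich _ (h1 k)).symm) hle

end LowComplexity

namespace LowComplexity

/-! ### Arithmetic of the word lengths -/

/-- The lengths `a k ≤ b k` of the two words of level `k`, the parameters `j k`, `d k` of the
`k`-th substitution and lower bounds `e k` for the excess in the number of factors. -/
structure Lengths (a b e j d : ℕ → ℕ) : Prop where
  pos : ∀ k, 0 < a k
  le : ∀ k, a k ≤ b k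
  succ_fst : ∀ k, a (k + 1) = j k * a k + b k
  succ_snd : ∀ k, b (k + 1) = (j k + d k + 1) * a k + b k
  excess : ∀ k, e k + d k * a k ≤ e (k + 1)
  bound : ∀ k, 3 * e k + 2 * (d k * a k) + 2 ≤ (j k + 1) * a k + b k

namespace Lengths

variable {a b e j d : ℕ → ℕ}

/-- The invariant from which the bounds on the parameters follow. -/
def Balanced (a b e : ℕ → ℕ) (k : ℕ) : Prop :=
  a k < b k ∧ (b k < 2 * a k ∨ b k < 3 * a k ∧ a k ≤ 2 * e k)

/-- If `d > j`, then `bound` forces `b ≥ (j + 1) * a + 3 * e + 2`, which both cases of `Balanced`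
exclude. -/
theorem le_of_pos (h : Lengths a b e j d) {k : ℕ} (hk : Balanced a b e k) (hj : 1 ≤ j k) :
    d k ≤ j k := by
  by_contra hc
  have h1 := h.bound k
  have h2 : (j k + 1) * a k ≤ d k * a k := Nat.mul_le_mul_right _ (by omega)
  have h3 : 1 * a k ≤ j k * a k := Nat.mul_le_mul_right _ hj
  have h4 : (j k + 1) * a k = j k * a k + a k := by ring
  obtain ⟨g1, g2⟩ := hk
  omega

theorem le_one (h : Lengths a b e j d) {k : ℕ} (hk : Balanced a b e k) (hj : j k = 0) :
    d k ≤ 1 := by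
  by_contra hc
  have h1 := h.bound k
  have h2 : 2 * a k ≤ d k * a k := Nat.mul_le_mul_right _ (by omega)
  rw [hj] at h1
  obtain ⟨g1, g2⟩ := hk
  omega

/-- Failure would force `b ≥ 2 * a + 3 * e + 2` once `j ≥ 4`. -/
theorem ten_mul_lt (h : Lengths a b e j d) {k : ℕ} (hk : Balanced a b e k) (hj : 4 ≤ j k) :
    10 * (j k + d k + 2) < 19 * (j k + 1) := by
  by_contra hc
  have h1 := h.bound k
  have h2 : (9 * j k) * a k ≤ (10 * d k + 1) * a k := Nat.mul_le_mul_right _ (by omega)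
  have h3 : 4 * a k ≤ j k * a k := Nat.mul_le_mul_right _ hj
  have h4 : (j k + 1) * a k = j k * a k + a k := by ring
  have h5 : (9 * j k) * a k = 9 * (j k * a k) := by ring
  have h6 : (10 * d k + 1) * a k = 10 * (d k * a k) + a k := by ring
  obtain ⟨g1, g2⟩ := hk
  omega

/-- A step with `j = 0`, `d = 1` requires three times the excess to stay below `b - a` at its level.
That difference is `(d + 1) * a` in terms of the previous level, whereas the previous step has
already created excess `d * a`. -/
theorem eq_zero_of_succ (h : Lengths a b e j d) {k : ℕ} (hj : j (k + 1) = 0)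
    (hd : d (k + 1) = 1) : d k = 0 := by
  by_contra hc
  have h1 := h.bound (k + 1)
  have h2 := h.excess k
  have h3 := h.succ_fst k
  have h4 := h.succ_snd k
  have h5 : 1 * a k ≤ d k * a k := Nat.mul_le_mul_right _ (by omega)
  have h6 : (j k + d k + 1) * a k = j k * a k + d k * a k + a k := by ring
  rw [hj, hd] at h1
  omega

theorem lt_succ (h : Lengths a b e j d) (k : ℕ) : a (k + 1) < b (k + 1) := by
  have h1 := h.pos k
  have h3 := h.succ_fst k
  have h4 := h.succ_snd k
  have h6 : (j k + d k + 1) * a k = j k * a k + d k * a k + a k := by ring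
  omega

/-- If `d ≤ j`, the new ratio is below two. The only other step is `j = 0`, `d = 1`, where the ratio
may approach three but the excess rises by `a`, giving the second alternative. -/
theorem balanced_succ (h : Lengths a b e j d) {k : ℕ} (hk : Balanced a b e k) :
    Balanced a b e (k + 1) := by
  refine ⟨h.lt_succ k, ?_⟩
  have h2 := h.excess k
  have h3 := h.succ_fst k
  have h4 := h.succ_snd k
  have h6 : (j k + d k + 1) * a k = j k * a k + d k * a k + a k := by ring
  have hk' := hk
  obtain ⟨g1, g2⟩ := hk'
  by_cases hdj : d k ≤ j k
  · have h5 : d k * a k ≤ j k * a k := Nat.mul_le_mul_right _ hdj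
    left
    omega
  · have hj : j k = 0 := by
      by_contra hj
      exact hdj (h.le_of_pos hk (by omega))
    have hd : d k = 1 := by
      have := h.le_one hk hj
      omega
    rw [hd] at h2
    rw [hj] at h3
    rw [hj, hd] at h4
    omega

/-- If the new ratio were still at least two, `bound` would give `d ≤ 1`, and `b ≥ 2 * a` would give
`d ≥ j + 1`. -/
theorem lt_two_mul_succ (h : Lengths a b e j d) {k : ℕ} (hk : 2 * a k ≤ b k)
    (hjd : ¬ (j k = 0 ∧ d k = 1)) : b (k + 1) < 2 * a (k + 1) := by
  have h1 := h.bound k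
  have h3 := h.succ_fst k
  have h4 := h.succ_snd k
  have h6 : (j k + d k + 1) * a k = j k * a k + d k * a k + a k := by ring
  have h7 : (j k + 1) * a k = j k * a k + a k := by ring
  have hpos := h.pos k
  by_contra hc
  have hj : j k = 0 := by
    by_contra hj
    have h8 : 1 * a k ≤ j k * a k := Nat.mul_le_mul_right _ (by omega)
    omega
  have hd2 : d k < 2 := by
    by_contra hd
    have h8 : 2 * a k ≤ d k * a k := Nat.mul_le_mul_right _ (by omega)
    have h9 : j k * a k = 0 := by rw [hj, zero_mul]
    omega
  have hd : d k = 0 := by omega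
  have h9 : j k * a k = 0 := by rw [hj, zero_mul]
  have h10 : d k * a k = 0 := by rw [hd, zero_mul]
  omega

/-- Otherwise levels 1 and 2 would both use `j = 0`, `d = 1`, against `eq_zero_of_succ`. -/
theorem exists_lt_two_mul (h : Lengths a b e j d) :
    ∃ k, a k < b k ∧ b k < 2 * a k := by
  by_contra hc
  push Not at hc
  have h1 := hc 1 (h.lt_succ 0)
  have h2 := hc 2 (h.lt_succ 1)
  have h3 := hc 3 (h.lt_succ 2)
  have g1 : j 1 = 0 ∧ d 1 = 1 := by
    by_contra hn
    exact absurd (h.lt_two_mul_succ h1 hn) (not_lt.2 h2)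
  have g2 : j 2 = 0 ∧ d 2 = 1 := by
    by_contra hn
    exact absurd (h.lt_two_mul_succ h2 hn) (not_lt.2 h3)
  have := h.eq_zero_of_succ g2.1 g2.2
  omega

theorem le_fst (h : Lengths a b e j d) (k : ℕ) : k ≤ a k := by
  induction k with
  | zero => omega
  | succ k ih =>
    have h3 := h.succ_fst k
    cases k with
    | zero => exact h.pos 1
    | succ k => have := h.lt_succ k; omega

end Lengths

end LowComplexity

namespace LowComplexity

variable {A : Type*} {x : ℤ → A} {q₀ : ℕ}

/-! ### The sequence of levels -/

/-- A level, with all its data. -/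
structure Stage (x : ℤ → A) (q₀ : ℕ) where
  π : Fin 2 → List A
  z : ℤ → Fin 2
  e : ℤ → ℤ
  s : List A
  level : Level x q₀ π z e s

/-- `S'` arises from `S` by a desubstitution step with parameters `j + 1 < j + d + 2`. -/
structure Stage.Next (S S' : Stage x q₀) (j d : ℕ) : Prop where
  word : S'.π = fun a => applyWord S.π (sigma (j + 1) (j + d + 2) a)
  coding : ∃ g, Coding S.z (sigma (j + 1) (j + d + 2)) S'.z g
  surj : ∀ b, ∃ i, S'.z i = b
  growth : numFac x (S.s.length + 1) + S'.s.length + d * (S.π 0).length ≤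
    numFac x (S'.s.length + 1) + S.s.length
  bound : 3 * (numFac x (S.s.length + 1) + d * (S.π 0).length) ≤
    4 * S.s.length + (j + d) * (S.π 0).length + 3

theorem exists_stages [Finite A] (hrec : BiRecurrent x) (hR : ¬ RightPeriodic x)
    (hL : ¬ LeftPeriodic x) (hb : ∀ q, q₀ ≤ q → 3 * numFac x q < 4 * q) :
    ∃ (S : ℕ → Stage x q₀) (j d : ℕ → ℕ), ∀ k, (S k).Next (S (k + 1)) (j k) (d k) := by
  have hstep : ∀ S : Stage x q₀, ∃ (S' : Stage x q₀) (j d : ℕ), S.Next S' j d := by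
    intro S
    obtain ⟨j, d, z', g, s', h1, h2, h3, h4, h5, h6⟩ := S.level.step hR hL hb
    refine ⟨⟨_, z', _, s', h4⟩, j, d, rfl, ⟨g, h1⟩, ?_, h5, h6⟩
    intro b
    fin_cases b
    · exact h2
    · exact h3
  obtain ⟨π, z, e, s, h⟩ := exists_level hrec hR hb
  choose nxt j d hnext using hstep
  refine ⟨fun k => nxt^[k] ⟨π, z, e, s, h⟩, fun k => j (nxt^[k] ⟨π, z, e, s, h⟩),
    fun k => d (nxt^[k] ⟨π, z, e, s, h⟩), fun k => ?_⟩
  dsimp only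
  rw [Function.iterate_succ_apply']
  exact hnext _

section Stages

variable {S : ℕ → Stage x q₀} {j d : ℕ → ℕ}

theorem lengths_of_stages [Finite A] (hS : ∀ k, (S k).Next (S (k + 1)) (j k) (d k))
    (hR : ¬ RightPeriodic x) :
    Lengths (fun k => ((S k).π 0).length) (fun k => ((S k).π 1).length)
      (fun k => numFac x ((S k).s.length + 1) - ((S k).s.length + 1)) j d := by
  -- This keeps the truncated subtraction defining the excess exact.
  have hN : ∀ k, (S k).s.length + 2 ≤ numFac x ((S k).s.length + 1) := by
    intro k
    have := numFac_add_le hR (Nat.zero_le ((S k).s.length + 1))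
    rw [numFac_zero] at this
    omega
  constructor
  · exact fun k => List.length_pos_iff.2 (S k).level.ne_nil
  · exact fun k => (S k).level.le
  · intro k
    simp only [(hS k).word]
    exact length_applyWord_sigma_zero _ _ _
  · intro k
    simp only [(hS k).word]
    exact length_applyWord_sigma_one _ _ _
  · intro k
    have h1 := (hS k).growth
    have h2 := hN k
    have h3 := hN (k + 1)
    omega
  · intro k
    have h1 := (hS k).bound
    have h2 := hN k
    have h3 := (S k).level.length_le
    have h4 : (j k + d k) * ((S k).π 0).length =
      j k * ((S k).π 0).length + d k * ((S k).π 0).length := by ring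
    have h5 : (j k + 1) * ((S k).π 0).length =
      j k * ((S k).π 0).length + ((S k).π 0).length := by ring
    omega

/-! ### Bounded gaps -/

/-- A set of integers with bounded gaps. -/
def Syndetic (T : Set ℤ) : Prop := ∃ R : ℕ, ∀ t : ℤ, ∃ j : ℤ, t ≤ j ∧ j ≤ t + R ∧ j ∈ T

theorem syndetic_univ : Syndetic Set.univ := ⟨0, fun t => ⟨t, le_rfl, by simp, trivial⟩⟩

theorem Coding.syndetic {A : Type*} {x : ℤ → A} {π : Fin 2 → List A} {z : ℤ → Fin 2} {e : ℤ → ℤ}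
    (h : Coding x π z e) (hπ : ∀ b, π b ≠ []) {T T' : Set ℤ} (hT : Syndetic T) (D : ℕ)
    (hD : ∀ t ∈ T, ∃ p ∈ T', e t - D ≤ p ∧ p ≤ e t + D) : Syndetic T' := by
  obtain ⟨R, hR⟩ := hT
  set M := (π 0).length + (π 1).length with hM
  have hb : ∀ b, (π b).length ≤ M := by
    intro b
    fin_cases b <;> simp [hM]
  have hgrow : ∀ u : ℤ, ∀ k : ℕ, e (u + k) ≤ e u + k * M := by
    intro u k
    induction k with
    | zero => simp
    | succ k ih =>
      have h1 := h.next (u + k)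
      have h2 := hb (z (u + k))
      push_cast
      rw [← add_assoc, h1]
      have : ((k : ℤ) + 1) * M = k * M + M := by ring
      omega
  refine ⟨2 * D + (R + 1) * M, fun t => ?_⟩
  obtain ⟨u, h1, h2⟩ := exists_block_of_strictMono (h.strictMono hπ) (t + D)
  obtain ⟨i, hi1, hi2, hiT⟩ := hR (u + 1)
  obtain ⟨p, hp, hp1, hp2⟩ := hD i hiT
  have h3 := (h.strictMono hπ).monotone hi1
  have h4 := (h.strictMono hπ).monotone hi2
  have h5 := hgrow u (R + 1)
  rw [show u + ((R + 1 : ℕ) : ℤ) = u + 1 + R by push_cast; ring] at h5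
  refine ⟨p, by omega, ?_, hp⟩
  push_cast at h5 ⊢
  omega

theorem exists_sigma_eq (j d : ℕ) (b : Fin 2) :
    ∃ v, sigma (j + 1) (j + d + 2) b = v ++ 1 :: List.replicate j 0 := by
  fin_cases b
  · exact ⟨[], rfl⟩
  · exact ⟨_, rfl⟩

theorem syndetic_one {z z' : ℤ → Fin 2} {g : ℤ → ℤ} {j d : ℕ}
    (h : Coding z (sigma (j + 1) (j + d + 2)) z' g) : Syndetic {t | z t = 1} := by
  refine h.syndetic (sigma_ne_nil _ _) syndetic_univ
    ((sigma (j + 1) (j + d + 2) 0).length + (sigma (j + 1) (j + d + 2) 1).length) fun t _ => ?_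
  have hb : (sigma (j + 1) (j + d + 2) (z' t)).length ≤
      (sigma (j + 1) (j + d + 2) 0).length + (sigma (j + 1) (j + d + 2) 1).length := by
    generalize z' t = b
    fin_cases b <;> simp
  obtain ⟨v, hv⟩ := exists_sigma_eq j d (z' t)
  have h1 := h.occ t
  rw [hv, show v ++ 1 :: List.replicate j 0 = v ++ [1] ++ List.replicate j 0 by simp] at h1
  have h2 := h1.of_infix
  rw [occ_singleton] at h2
  rw [hv, List.length_append] at hb
  exact ⟨_, h2, by omega, by push_cast at hb ⊢; omega⟩

theorem syndetic_zero {z z' : ℤ → Fin 2} {g : ℤ → ℤ} {j d : ℕ}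
    (h : Coding z (sigma (j + 1) (j + d + 2)) z' g) (h1 : Syndetic {t | z' t = 1}) :
    Syndetic {t | z t = 0} := by
  refine h.syndetic (sigma_ne_nil _ _) h1 0 fun t ht => ⟨g t, ?_, by simp, by simp⟩
  have h2 := h.head?_eq (sigma_ne_nil _ _) t
  rw [ht] at h2
  simp [sigma, show j + d + 2 - (j + 1) = d + 1 by omega, List.replicate_succ] at h2
  exact h2.symm

/-- A pair inside a block recurs with that block. A pair across a boundary depends only on the
following block, since all blocks end in `1 0 ^ j`. -/
theorem syndetic_pair {z z' : ℤ → Fin 2} {g : ℤ → ℤ} {j d : ℕ}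
    (h : Coding z (sigma (j + 1) (j + d + 2)) z' g) (h1 : ∀ b, Syndetic {t | z' t = b}) (t₀ : ℤ) :
    Syndetic {t | z t = z t₀ ∧ z (t + 1) = z (t₀ + 1)} := by
  obtain ⟨u, hu1, hu2⟩ := exists_block_of_strictMono (h.strictMono (sigma_ne_nil _ _)) t₀
  have hblock : ∀ u t, z' t = z' u → fac z (g t) (sigma (j + 1) (j + d + 2) (z' u)).length =
      fac z (g u) (sigma (j + 1) (j + d + 2) (z' u)).length := by
    intro u t htu
    have o1 := h.occ t
    rw [htu] at o1
    exact o1.fac_eq (h.occ u)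
  by_cases hc : t₀ + 1 < g (u + 1)
  · refine h.syndetic (sigma_ne_nil _ _) (h1 (z' u)) (t₀ - g u).toNat fun t ht =>
      ⟨g t + (t₀ - g u), ?_, by omega, by omega⟩
    have h2 := hblock u t ht
    have h3 := h.next u
    have e1 := fac_eq_apply h2 (t₀ - g u) (by omega) (by omega)
    have e2 := fac_eq_apply h2 (t₀ - g u + 1) (by omega) (by omega)
    rw [show g u + (t₀ - g u) = t₀ by ring] at e1
    rw [show g u + (t₀ - g u + 1) = t₀ + 1 by ring] at e2
    exact ⟨e1, by rw [← e2]; congr 1; ring⟩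
  · have hg : t₀ + 1 = g (u + 1) := by omega
    have hend : ∀ t, EndsAt z (1 :: List.replicate j 0) (g t) := by
      intro t
      have h2 := h.occ (t - 1)
      have h3 := h.next (t - 1)
      rw [sub_add_cancel] at h3
      obtain ⟨v, hv⟩ := exists_sigma_eq j d (z' (t - 1))
      rw [hv] at h2 h3
      refine Occ.of_suffix (w := v ++ 1 :: List.replicate j 0) ?_ (List.suffix_append _ _)
      convert h2 using 1
      omega
    refine h.syndetic (sigma_ne_nil _ _) (h1 (z' (u + 1))) 1 fun t ht =>
      ⟨g t - 1, ?_, by simp, by omega⟩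
    have h2 := hblock (u + 1) t ht
    have h3 := fac_eq_apply h2 0 le_rfl (by
      have := List.length_pos_iff.2 (sigma_ne_nil (j + 1) (j + d + 2) (z' (u + 1)))
      omega)
    have h4 := fac_eq_apply ((hend t).trans (hend (u + 1)).symm) j (by omega) (by simp)
    simp only [List.length_cons, List.length_replicate, add_zero] at h3 h4
    constructor
    · rw [show t₀ = g (u + 1) - 1 by omega]
      convert h4 using 2 <;> push_cast <;> ring
    · rw [sub_add_cancel, hg]
      exact h3

/-- At level `q` the blocks have length at least `q`, so a factor of length `q` lies in two
consecutive blocks. -/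
theorem syndetic_fac [Finite A] (hS : ∀ k, (S k).Next (S (k + 1)) (j k) (d k))
    (hR : ¬ RightPeriodic x) (i : ℤ) (q : ℕ) : Syndetic {p | fac x p q = fac x i q} := by
  have hle := (lengths_of_stages hS hR).le_fst q
  have hle' := (S q).level.le
  have hq : ∀ b, q ≤ ((S q).π b).length := by
    intro b
    fin_cases b
    · exact hle
    · exact hle.trans hle'
  have hone : ∀ k, Syndetic {t | (S k).z t = 1} := by
    intro k
    obtain ⟨g, hg⟩ := (hS k).coding
    exact syndetic_one hg
  have hletter : ∀ k b, Syndetic {t | (S k).z t = b} := by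
    intro k b
    fin_cases b
    · obtain ⟨g, hg⟩ := (hS k).coding
      exact syndetic_zero hg (hone (k + 1))
    · exact hone k
  have hcod := (S q).level.coding
  have hmono := hcod.strictMono (S q).level.forall_ne_nil
  obtain ⟨u, h1, h2⟩ := exists_block_of_strictMono hmono i
  obtain ⟨g, hg⟩ := (hS q).coding
  refine hcod.syndetic (S q).level.forall_ne_nil (syndetic_pair hg (hletter (q + 1)) u)
    (i - (S q).e u).toNat fun t ht => ⟨(S q).e t + (i - (S q).e u), ?_, by omega, by omega⟩
  have hf : fac (S q).z t 2 = fac (S q).z u 2 := by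
    rw [fac_succ_left, fac_one, fac_succ_left, fac_one, ht.1, ht.2]
  have o1 := hcod.occ_applyWord t 2
  have o2 := hcod.occ_applyWord u 2
  rw [hf] at o1
  have h3 := hcod.next (u + 1)
  have h4 := hq ((S q).z (u + 1))
  rw [show u + 1 + 1 = u + (2 : ℕ) by push_cast; ring] at h3
  have := fac_eq_sub (o1.1.fac_eq o2.1) (i - (S q).e u) (by omega) q (by omega)
  rwa [show (S q).e u + (i - (S q).e u) = i by ring] at this

theorem closure_orbit_eq_of_mem [Finite A] [TopologicalSpace A] [DiscreteTopology A]
    (hS : ∀ k, (S k).Next (S (k + 1)) (j k) (d k)) (hR : ¬ RightPeriodic x) {y : ℤ → A}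
    (hy : y ∈ closure (orbit x)) : closure (orbit y) = closure (orbit x) := by
  refine closure_orbit_eq hy fun i q => ?_
  obtain ⟨R, hRq⟩ := syndetic_fac hS hR i q
  obtain ⟨t, ht⟩ := mem_closure_orbit_iff.1 hy 0 (R + q)
  obtain ⟨p, hp1, hp2, hp⟩ := hRq t
  have := fac_eq_sub ht (p - t) (by omega) q (by push_cast; omega)
  rw [show t + (p - t) = p by ring, hp] at this
  exact ⟨_, this.symm⟩

/-! ### Passing from `sigma` to `tau` -/

theorem tau_append (m d : ℕ) (a : Fin 2) :
    tau (m + 1) (m + d + 2) a ++ List.replicate m 0 =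
      List.replicate m 0 ++ sigma (m + 1) (m + d + 2) a := by
  have h2 : m + d + 2 - (m + 1) = d + 1 := by omega
  obtain rfl | rfl : a = 0 ∨ a = 1 := by omega
  · simp [tau, sigma]
  · have e1 : tau (m + 1) (m + d + 2) 1 = List.replicate (m + (d + 1)) 0 ++ [1] := rfl
    have e2 : sigma (m + 1) (m + d + 2) 1 =
        List.replicate (d + 1) 0 ++ 1 :: List.replicate m 0 := by
      simp [sigma, h2]
    rw [e1, e2, List.replicate_add]
    simp only [List.append_assoc, List.cons_append, List.nil_append]

theorem applyWord_conj {B : Type*} {φ ψ : B → List A} {P : List A}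
    (h : ∀ b, φ b ++ P = P ++ ψ b) (w : List B) :
    applyWord φ w ++ P = P ++ applyWord ψ w := by
  induction w with
  | nil => simp
  | cons b w ih =>
    rw [applyWord_cons, applyWord_cons, List.append_assoc, ih, ← List.append_assoc, h,
      List.append_assoc]

theorem applyWord_rho_succ (π : Fin 2 → List A) (m n : ℕ → ℕ) (k : ℕ) (a : Fin 2) :
    applyWord π (rho m n (k + 1) a) =
      applyWord (fun b => applyWord π (rho m n k b)) (tau (m k) (n k) a) :=
  applyWord_applyWord _ _ _

/-- The conjugating prefixes accumulate, because a substitution maps conjugate words to conjugate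
words. -/
theorem exists_conj_rho (hS : ∀ k, (S k).Next (S (k + 1)) (j k) (d k)) (k : ℕ) :
    ∃ P, ∀ a, applyWord (S 0).π (rho (fun k => j k + 1) (fun k => j k + d k + 2) k a) ++ P =
      P ++ (S k).π a := by
  induction k with
  | zero => exact ⟨[], fun a => by simp [rho]⟩
  | succ k ih =>
    obtain ⟨P, hP⟩ := ih
    have hPw := applyWord_conj hP
    refine ⟨applyWord (fun b => applyWord (S 0).π
      (rho (fun k => j k + 1) (fun k => j k + d k + 2) k b)) (List.replicate (j k) 0) ++ P,
      fun a => ?_⟩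
    rw [applyWord_rho_succ, ← List.append_assoc, ← applyWord_append, tau_append, (hS k).word,
      applyWord_append, List.append_assoc, hPw, ← List.append_assoc]

theorem applyWord_rho_ne_nil {π : Fin 2 → List A} (hπ : ∀ b, π b ≠ []) (m n : ℕ → ℕ) (k : ℕ)
    (a : Fin 2) : applyWord π (rho m n k a) ≠ [] := by
  induction k generalizing a with
  | zero => simpa [rho] using hπ a
  | succ k ih =>
    rw [applyWord_rho_succ]
    intro h
    have h1 := length_le_length_applyWord ih (tau (m k) (n k) a)
    rw [h] at h1
    have h2 : tau (m k) (n k) a ≠ [] := by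
      unfold tau
      split <;> simp
    exact h2 (List.length_eq_zero_iff.1 (by simpa using h1))

/-- The words `(π ∘ τ ∘ ⋯ ∘ τ) a` occur in `x`. -/
theorem exists_occ_rho (hS : ∀ k, (S k).Next (S (k + 1)) (j k) (d k)) {k : ℕ} {a : Fin 2}
    (ha : ∃ t, (S k).z t = a) :
    ∃ i, Occ (applyWord (S 0).π (rho (fun k => j k + 1) (fun k => j k + d k + 2) k a)) x i := by
  obtain ⟨P, hP⟩ := exists_conj_rho hS k
  obtain ⟨t, rfl⟩ := ha
  set W := fun b => applyWord (S 0).π (rho (fun k => j k + 1) (fun k => j k + d k + 2) k b) with hW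
  have hWne : ∀ b, W b ≠ [] := fun b => applyWord_rho_ne_nil (S 0).level.forall_ne_nil _ _ k b
  have ho := ((S k).level.coding.occ_applyWord (t - P.length) (P.length + 1)).1
  rw [fac_succ, sub_add_cancel] at ho
  set c := fac (S k).z (t - P.length) P.length with hc
  have hlen : P.length ≤ (applyWord W c).length := by
    have := length_le_length_applyWord hWne c
    rwa [hc, length_fac] at this
  have heq := applyWord_conj (φ := W) hP (c ++ [(S k).z t])
  rw [applyWord_append, List.append_assoc] at heq
  -- With `P.length` nonempty blocks in front, the conjugator is absorbed into `applyWord W c`;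
  -- after cancelling it, `W` of the last letter is seen inside a word occurring in `x`.
  obtain ⟨R, hRe⟩ : P <+: applyWord W c :=
    List.prefix_of_prefix_length_le (l₃ := P ++ applyWord (S k).π (c ++ [(S k).z t]))
      (List.prefix_append _ _) (by rw [← heq]; exact List.prefix_append _ _) hlen
  rw [← hRe, List.append_assoc, List.append_cancel_left_eq] at heq
  rw [← heq, applyWord_cons, applyWord_nil, List.append_nil, ← List.append_assoc] at ho
  exact ⟨_, ho.of_infix⟩

end Stages

end LowComplexity

namespace LowComplexity

variable {A : Type*}

/-! ### Points containing one-sided infinite words -/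

/-- If every word `u k` occurs at position `p k` of a translate of `x`, compatibly, some point of
the orbit closure contains all of them. -/
theorem exists_mem_closure_orbit [Finite A] [TopologicalSpace A] [DiscreteTopology A] {x : ℤ → A}
    (u : ℕ → List A) (p : ℕ → ℤ) (hu : ∀ k, ∃ i, Occ (u k) x i)
    (hmono : ∀ k (y : ℤ → A), Occ (u (k + 1)) y (p (k + 1)) → Occ (u k) y (p k)) :
    ∃ y ∈ closure (orbit x), ∀ k, Occ (u k) y (p k) := by
  have hcl : ∀ k, IsClosed {y : ℤ → A | Occ (u k) y (p k)} := fun k => isClosed_setOf_fac_eq _ _ _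
  have hcl' : ∀ k, IsClosed (closure (orbit x) ∩ {y : ℤ → A | Occ (u k) y (p k)}) := fun k =>
    isClosed_closure.inter (hcl k)
  obtain ⟨y, hy⟩ := IsCompact.nonempty_iInter_of_sequence_nonempty_isCompact_isClosed
    (fun k => closure (orbit x) ∩ {y : ℤ → A | Occ (u k) y (p k)})
    (fun k y hy => ⟨hy.1, hmono k y hy.2⟩)
    (fun k => by
      obtain ⟨s, hs, he⟩ := fac_orbit.2 (hu k)
      exact ⟨s, subset_closure hs, he⟩)
    (hcl' 0).isCompact hcl'
  rw [Set.mem_iInter] at hy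
  exact ⟨y, (hy 0).1, fun k => (hy k).2⟩

theorem isOrbitClosureOfRightInfinite [Finite A] [TopologicalSpace A] [DiscreteTopology A]
    {x : ℤ → A} (hmin : ∀ y ∈ closure (orbit x), closure (orbit y) = closure (orbit x))
    {w : ℕ → List A} (hw : ∀ k, 1 ≤ k → ∃ i, Occ (w k) x i) {y : ℕ → A}
    (hy : ConvergesRightInfinite w y) :
    IsOrbitClosureOfRightInfinite (closure (orbit x)) y := by
  obtain ⟨v, hv, hvy⟩ := exists_mem_closure_orbit (x := x) (fun k => (List.range k).map y)
    (fun _ => 0) (fun k => by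
      have h1 : ∀ᶠ l in Filter.atTop, ∀ i ∈ Finset.range k, (w l)[i]? = some (y i) :=
        (Filter.eventually_all_finset _).2 fun i _ => hy i
      obtain ⟨l, hl, hl1⟩ := (h1.and (Filter.eventually_ge_atTop 1)).exists
      obtain ⟨i, hi⟩ := hw l hl1
      refine ⟨i, ?_⟩
      rw [occ_iff_getElem] at hi ⊢
      intro j hj
      simp only [List.length_map, List.length_range] at hj
      have h2 := hl j (Finset.mem_range.2 hj)
      obtain ⟨h3, h4⟩ := List.getElem?_eq_some_iff.1 h2
      rw [hi j h3, h4]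
      simp) (fun k v hv => by
      rw [List.range_succ, List.map_append, occ_append] at hv
      exact hv.1)
  refine ⟨v, hv, ⟨0, fun j => ?_⟩, (hmin v hv).symm⟩
  have := hvy (j + 1)
  rw [List.range_succ, List.map_append, occ_append] at this
  have := this.2
  rw [List.map_singleton, occ_singleton] at this
  simpa using this

/-- Words `w k`, each ending with the previous one of a sequence of growing words `v k`, converge
to a left-infinite word. -/
theorem exists_convergesLeftInfinite [Finite A] [TopologicalSpace A] [DiscreteTopology A]
    {x : ℤ → A} (hmin : ∀ y ∈ closure (orbit x), closure (orbit y) = closure (orbit x))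
    {w v : ℕ → List A} (hv : ∀ k, 1 ≤ k → ∃ i, Occ (v k) x i) (hlen : ∀ k, k < (v k).length)
    (hvv : ∀ k, v k <:+ v (k + 1)) (hvw : ∀ k, v k <:+ w (k + 1)) :
    ∃ y, ConvergesLeftInfinite w y ∧ IsOrbitClosureOfLeftInfinite (closure (orbit x)) y := by
  have hsuff : ∀ i k, i ≤ k → v i <:+ v k := by
    intro i k hik
    induction k, hik using Nat.le_induction with
    | base => exact List.suffix_rfl
    | succ k _ ih => exact ih.trans (hvv k)
  refine ⟨fun i => (v i).reverse[i]'(by simpa using hlen i), ?_, ?_⟩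
  · intro i
    filter_upwards [Filter.eventually_ge_atTop (i + 1)] with k hk
    obtain ⟨k, rfl⟩ : ∃ l, k = l + 1 := ⟨k - 1, by omega⟩
    obtain ⟨t, ht⟩ := (hsuff i k (by omega)).trans (hvw k)
    rw [← ht, List.reverse_append, List.getElem?_append_left (by simpa using hlen i)]
    exact List.getElem?_eq_getElem _
  · obtain ⟨y, hy, hyv⟩ := exists_mem_closure_orbit (x := x) (fun k => v (k + 1))
      (fun k => 1 - (v (k + 1)).length) (fun k => hv (k + 1) (by omega))
      (fun k y hy => hy.of_suffix (hvv (k + 1)))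
    refine ⟨y, hy, ⟨0, fun j => ?_⟩, (hmin y hy).symm⟩
    have h1 := (hyv j).of_suffix (hvv j)
    have h2 := hlen j
    rw [occ_iff_getElem] at h1
    have h3 := h1 ((v j).length - 1 - j) (by omega)
    dsimp only
    rw [List.getElem_reverse, ← h3]
    congr 1
    omega

end LowComplexity

/-! ### Assembly of the main theorem -/

open LowComplexity

theorem proposition2p3 {A : Type*} [Finite A] [TopologicalSpace A] [DiscreteTopology A]
    (X : Set (ℤ → A)) (hX : LowComplexity.IsSubshift X) (hinf : X.Infinite)
    (htrans : LowComplexity.IsTransitive X)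
    (hper : ¬ ∃ x : ℤ → A, LowComplexity.EventuallyPeriodicBothSides x ∧
      X = closure (LowComplexity.orbit x))
    (hlim : Filter.limsup
      (fun q : ℕ => (LowComplexity.complexity X q : ENNReal) / (q : ENNReal))
      Filter.atTop < 4 / 3) :
    ∃ (π : Fin 2 → List A) (m n : ℕ → ℕ),
      (π 0).head? ≠ (π 1).head? ∧
      (π 0).length < (π 1).length ∧ (π 1).length < 2 * (π 0).length ∧
      (∀ k, 0 < m k ∧ m k < n k) ∧
      (∃ y : ℕ → A,
        LowComplexity.ConvergesLeftInfinite
          (fun k => LowComplexity.applyWord π (LowComplexity.rho m n k 0)) y ∧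
        LowComplexity.IsOrbitClosureOfLeftInfinite X y) ∧
      (∀ y : ℕ → A,
        LowComplexity.ConvergesRightInfinite
          (fun k => LowComplexity.applyWord π (LowComplexity.rho m n k 0)) y →
        LowComplexity.IsOrbitClosureOfRightInfinite X y) ∧
      (∀ k, 1 < m k → n k ≤ 2 * m k) ∧
      (∀ k, 4 < m k → (n k : ℝ) < 1.9 * (m k : ℝ)) ∧
      (∀ k, m k = 1 → n k ≤ 3) ∧
      (∀ k, m (k + 1) = 1 → n (k + 1) = 3 → n k = m k + 1) ∧
      (∃ s : List A, LowComplexity.IsMaxCommonSuffix (π 0) (π 1) s ∧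
        ∀ w : List A, LowComplexity.IsRightSpecial X w →
          s.length + (m 0 - 1) * (π 0).length ≤ w.length →
          ∃ c : List (Fin 2), w <:+ LowComplexity.applyWord π c) := by
  obtain ⟨x, rfl, hrec, hR, hL, q₀, hb⟩ := exists_recurrent_generator hinf htrans hper hlim
  obtain ⟨S, j, d, hS⟩ := exists_stages hrec hR hL hb
  have hlen := lengths_of_stages hS hR
  -- The substitution `π` of the theorem is the pair of words at this level; earlier levels are
  -- discarded.
  obtain ⟨k₀, hk1, hk2⟩ := hlen.exists_lt_two_mul
  have hbal : ∀ k, Lengths.Balanced (fun k => ((S k).π 0).length) (fun k => ((S k).π 1).length)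
      (fun k => numFac x ((S k).s.length + 1) - ((S k).s.length + 1)) (k₀ + k) := by
    intro k
    induction k with
    | zero => exact ⟨hk1, Or.inl hk2⟩
    | succ k ih => exact hlen.balanced_succ ih
  have hS' : ∀ k, (S (k₀ + k)).Next (S (k₀ + (k + 1))) (j (k₀ + k)) (d (k₀ + k)) :=
    fun k => hS (k₀ + k)
  have hmin := fun (y : ℤ → A) (hy : y ∈ closure (orbit x)) => closure_orbit_eq_of_mem hS hR hy
  have hocc : ∀ a k, 1 ≤ k → ∃ i, Occ (applyWord (S k₀).π
      (rho (fun k => j (k₀ + k) + 1) (fun k => j (k₀ + k) + d (k₀ + k) + 2) k a)) x i := by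
    intro a k hk
    obtain ⟨k, rfl⟩ : ∃ l, k = l + 1 := ⟨k - 1, by omega⟩
    exact exists_occ_rho (S := fun k => S (k₀ + k)) hS' ((hS' k).surj a)
  have hne : ∀ k a, applyWord (S k₀).π
      (rho (fun k => j (k₀ + k) + 1) (fun k => j (k₀ + k) + d (k₀ + k) + 2) k a) ≠ [] :=
    fun k a => applyWord_rho_ne_nil (S k₀).level.forall_ne_nil _ _ k a
  -- Both images under `tau` end in `1`, so the words of either letter at level `k + 1` end with the
  -- word of `1` at level `k`. The words of `1` strictly grow and carry the left-infinite limit.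
  have hsucc : ∀ k a, ∃ u, applyWord (S k₀).π
      (rho (fun k => j (k₀ + k) + 1) (fun k => j (k₀ + k) + d (k₀ + k) + 2) (k + 1) a) =
      u ++ applyWord (S k₀).π
        (rho (fun k => j (k₀ + k) + 1) (fun k => j (k₀ + k) + d (k₀ + k) + 2) k 1) ∧
      (a = 1 → u ≠ []) := by
    intro k a
    rw [applyWord_rho_succ]
    obtain rfl | rfl : a = 0 ∨ a = 1 := by omega
    · exact ⟨_, by rw [tau, if_pos rfl, applyWord_append, applyWord_cons, applyWord_nil,
        List.append_nil], by simp⟩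
    · refine ⟨_, by rw [tau, if_neg (by simp), applyWord_append, applyWord_cons, applyWord_nil,
        List.append_nil], fun _ h0 => ?_⟩
      have := length_le_length_applyWord (hne k)
        (List.replicate (j (k₀ + k) + d (k₀ + k) + 2 - 1) 0)
      rw [h0, List.length_replicate] at this
      simp at this
  refine ⟨(S k₀).π, fun k => j (k₀ + k) + 1, fun k => j (k₀ + k) + d (k₀ + k) + 2,
    (S k₀).level.head_ne, hk1, hk2, fun k => ⟨by dsimp only; omega, by dsimp only; omega⟩, ?_, ?_, ?_, ?_, ?_, ?_, ?_⟩
  · refine exists_convergesLeftInfinite hmin (hocc 1) ?_ ?_ ?_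
    · intro k
      induction k with
      | zero => exact List.length_pos_iff.2 (hne 0 1)
      | succ k ih =>
        obtain ⟨u, hu, hu0⟩ := hsucc k 1
        have := List.length_pos_iff.2 (hu0 rfl)
        rw [hu, List.length_append]
        omega
    · intro k
      obtain ⟨u, hu, -⟩ := hsucc k 1
      exact ⟨u, hu.symm⟩
    · intro k
      obtain ⟨u, hu, -⟩ := hsucc k 0
      exact ⟨u, hu.symm⟩
  · intro y hy
    exact isOrbitClosureOfRightInfinite hmin (hocc 0) hy
  · intro k hk
    dsimp only at hk ⊢
    have := hlen.le_of_pos (hbal k) (by omega)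
    omega
  · intro k hk
    dsimp only at hk ⊢
    have := hlen.ten_mul_lt (hbal k) (by omega)
    have h2 : (10 * (j (k₀ + k) + d (k₀ + k) + 2 : ℕ) : ℝ) < 19 * (j (k₀ + k) + 1 : ℕ) := by
      exact_mod_cast this
    linarith
  · intro k hk
    dsimp only at hk ⊢
    have := hlen.le_one (hbal k) (by omega)
    omega
  · intro k hk hk'
    dsimp only at hk hk' ⊢
    rw [← add_assoc] at hk hk'
    have := hlen.eq_zero_of_succ (k := k₀ + k) (by omega) (by omega)
    omega
  · obtain ⟨α, β, hαβ, hs⟩ := (S k₀).level.split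
    refine ⟨(S k₀).s, hs.isMaxCommonSuffix hαβ, fun w hw hwl => ?_⟩
    obtain ⟨hwX, a, b, hab, ha, hbX⟩ := hw
    rw [mem_language_iff] at hwX ha hbX
    obtain ⟨i, hi⟩ := hwX
    obtain ⟨i₁, h1⟩ := ha
    obtain ⟨i₂, h2⟩ := hbX
    rw [occ_append, occ_singleton] at h1 h2
    have hrs : RightSpecial x w := ⟨i₁, i₂, h1.1, h2.1, by rw [h1.2, h2.2]; exact hab⟩
    -- Length `s.length` already suffices here. As blocks are nonempty, the `w.length` blocks before
    -- the cut cover `w`.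
    obtain ⟨t, ht⟩ := (S k₀).level.cut w hrs (by omega) i hi
    have hcod := (S k₀).level.coding.occ_applyWord (t - w.length) w.length
    rw [sub_add_cancel] at hcod
    refine ⟨fac (S k₀).z (t - w.length) w.length, ?_⟩
    set v := applyWord (S k₀).π (fac (S k₀).z (t - w.length) w.length) with hv
    have hvl : w.length ≤ v.length := by
      have := length_le_length_applyWord (S k₀).level.forall_ne_nil
        (fac (S k₀).z (t - w.length) w.length)
      rwa [length_fac] at this
    obtain ⟨l, hl⟩ := Nat.exists_eq_add_of_le' hvl
    have h3 : fac x ((S k₀).e (t - w.length)) v.length = v := hcod.1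
    rw [hl, fac_add] at h3
    refine ⟨fac x ((S k₀).e (t - w.length)) l, ?_⟩
    rw [← h3]
    congr 1
    rw [show (S k₀).e (t - w.length) + l = i by omega]
    exact Eq.symm hi
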